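/- Let $Q$ be a finite-dimensional smooth (Hausdorff) manifold with a smooth Riemannian metric, let $G$ be a (finite-dimensional) Lie group acting smoothly, properly and by isometries on $Q$, $\Phi_g(x)=g\cdot x$, and let $X$ be a smooth $G$-equivariant vector field on $Q$, i.e. $T_x\Phi_g(X(x))=X(\Phi_g(x))$ for all $g\in G$, $x\in Q$. Let $q_e\in Q$ and let $G_{q_e}=\{h\in G\mid h\cdot q_e=q_e\}$ act linearly on $T_{q_e}Q$ by $h\cdot v=T_{q_e}\Phi_h(v)$. Let $\operatorname{Exp}_{q_e}$ be the Riemannian exponential map at $q_e$, defined on the set of those $v\in T_{q_e}Q$ for which the geodesic with initial point $q_e$ and initial velocity $v$ exists on $[0,1]$. Consider pairs $(V,U)$ where $V$ is a $G_{q_e}$-invariant open neighborhood of $0$ in $T_{q_e}Q$, contained in the domain of $\operatorname{Exp}_{q_e}$, $U\subset Q$ is open, and $\operatorname{Exp}_{q_e}$ restricts to a smooth diffeomorphism $V\to U$, with inverse $\operatorname{Log}_{q_e}:U\to V$. Then: 1. Such pairs exist, and they can be chosen with $V$ inside any prescribed neighborhood of $0$ and $U$ inside any prescribed neighborhood of $q_e$.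 2. For every such pair, $U$ is a $G_{q_e}$-invariant neighborhood of $q_e$, and the pulled back vector field $$\bigl(\operatorname{Exp}_{q_e}^*(X|_U)\bigr)(v)=(T_v\operatorname{Exp}_{q_e})^{-1}\bigl(X(\operatorname{Exp}_{q_e}(v))\bigr)=T_{\operatorname{Exp}_{q_e}(v)}\operatorname{Log}_{q_e}\bigl(X(\operatorname{Exp}_{q_e}(v))\bigr),\qquad v\in V,$$ is a smooth vector field on $V$ and is $G_{q_e}$-equivariant: for all $h\in G_{q_e}$ and $v\in V$, $$\bigl(\operatorname{Exp}_{q_e}^*(X|_U)\bigr)(T_{q_e}\Phi_h(v))=T_v(T_{q_e}\Phi_h)\Bigl(\bigl(\operatorname{Exp}_{q_e}^*(X|_U)\bigr)(v)\Bigr).$$ -/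

import Mathlib

open Set Topology Bundle
open scoped Manifold ContDiff

section Geodesics

variable {E : Type*} [NormedAddCommGroup E] [NormedSpace ℝ E]
  {Q : Type*} [TopologicalSpace Q] [ChartedSpace E Q]
  [RiemannianBundle (fun x : Q ↦ TangentSpace 𝓘(ℝ, E) x)]

/-- The Riemannian metric read in the chart `e`: the inner product, at the point with coordinate
`y`, of the tangent vectors with coordinates `u` and `v`. -/
noncomputable def chartMetric (e : OpenPartialHomeomorph Q E) (y u v : E) : ℝ :=
  inner ℝ (mfderiv 𝓘(ℝ, E) 𝓘(ℝ, E) e.symm y u) (mfderiv 𝓘(ℝ, E) 𝓘(ℝ, E) e.symm y v)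

/-- The Christoffel symbols of the first kind of the Levi-Civita connection in the chart `e`,
`Γ(u, v; w) = (∂_u g(v, w) + ∂_v g(u, w) - ∂_w g(u, v)) / 2`, that is, the `g`-inner product of
`∇_u v` with `w` for the constant coordinate fields `u`, `v`, `w`. -/
noncomputable def chartChristoffel (e : OpenPartialHomeomorph Q E) (y u v w : E) : ℝ :=
  (fderiv ℝ (fun z ↦ chartMetric e z v w) y u + fderiv ℝ (fun z ↦ chartMetric e z u w) y v
    - fderiv ℝ (fun z ↦ chartMetric e z u v) y w) / 2

/-- `γ` is a geodesic of the Riemannian manifold `Q` on the open set of times `J`: it is of class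
`C²` there, and in every smooth chart `e` its coordinate expression `c = e ∘ γ` satisfies the
geodesic equation `c'' + Γ(c', c') = 0`. The equation is an identity of coordinate vectors; it is
tested against all `w` in the metric, so that no index has to be raised. -/
def IsGeodesicOn (γ : ℝ → Q) (J : Set ℝ) : Prop :=
  ContMDiffOn 𝓘(ℝ, ℝ) 𝓘(ℝ, E) 2 γ J ∧
    ∀ e ∈ IsManifold.maximalAtlas 𝓘(ℝ, E) ∞ Q, ∀ t ∈ J, γ t ∈ e.source → ∀ w : E,
      chartMetric e (e (γ t)) (deriv (deriv (fun s ↦ e (γ s))) t) w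
        + chartChristoffel e (e (γ t)) (deriv (fun s ↦ e (γ s)) t)
            (deriv (fun s ↦ e (γ s)) t) w = 0

/-- `γ` is a geodesic, on an open interval that contains `[0, 1]`, with `γ 0 = q` and initial
velocity `v`. -/
def IsUnitTimeGeodesic (q : Q) (v : TangentSpace 𝓘(ℝ, E) q) (γ : ℝ → Q) : Prop :=
  (∃ J : Set ℝ, IsOpen J ∧ J.OrdConnected ∧ Icc 0 1 ⊆ J ∧ IsGeodesicOn (E := E) γ J) ∧
    (⟨γ 0, mfderiv 𝓘(ℝ, ℝ) 𝓘(ℝ, E) γ 0 (1 : ℝ)⟩ : TangentBundle 𝓘(ℝ, E) Q) = ⟨q, v⟩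

/-- The domain in `T_q Q` of the Riemannian exponential map at `q`. -/
def expDomain (q : Q) : Set (TangentSpace 𝓘(ℝ, E) q) :=
  {v | ∃ γ : ℝ → Q, IsUnitTimeGeodesic q v γ}

open Classical in
/-- The Riemannian exponential map `Exp_q`: the value at time `1` of the geodesic that starts at
`q` with velocity `v`. It is meaningful on `expDomain q`, and set to `q` elsewhere. -/
noncomputable def riemannianExp (q : Q) (v : TangentSpace 𝓘(ℝ, E) q) : Q :=
  if h : ∃ γ : ℝ → Q, IsUnitTimeGeodesic q v γ then h.choose 1 else q

end Geodesics

section Actions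

variable {E : Type*} [NormedAddCommGroup E] [NormedSpace ℝ E]
  {Q : Type*} [TopologicalSpace Q] [ChartedSpace E Q]
  {G : Type*} [Group G] [MulAction G Q]

variable (E) in
/-- The isotropy representation `h ↦ T_q Φ_h` of `G_q` on `T_q Q`. The derivative of `Φ_h` at `q`
takes its values in the tangent space at `h • q = q`. -/
noncomputable def isotropyRep (q : Q) (h : MulAction.stabilizer G q) :
    TangentSpace 𝓘(ℝ, E) q →L[ℝ] TangentSpace 𝓘(ℝ, E) q :=
  mfderiv 𝓘(ℝ, E) 𝓘(ℝ, E) (fun x : Q ↦ (h : G) • x) q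

/-- `isotropyRep` is the restriction to `T_q Q` of the lifted action on the tangent bundle. -/
theorem isotropyRep_eq_tangentMap (q : Q) (h : MulAction.stabilizer G q)
    (v : TangentSpace 𝓘(ℝ, E) q) :
    (⟨q, isotropyRep E q h v⟩ : TangentBundle 𝓘(ℝ, E) Q) =
      tangentMap 𝓘(ℝ, E) 𝓘(ℝ, E) (fun x : Q ↦ (h : G) • x) ⟨q, v⟩ := by
  have key : ∀ (p : Q), p = q → ∀ a : E,
      (⟨q, a⟩ : TangentBundle 𝓘(ℝ, E) Q) = ⟨p, a⟩ := by
    rintro p rfl a; rfl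
  exact key _ h.2 _

variable (E) (Q) (G) in
/-- `G` acts by isometries: each `T_x Φ_g` preserves the Riemannian inner products. -/
def ActsByIsometries [RiemannianBundle (fun x : Q ↦ TangentSpace 𝓘(ℝ, E) x)] : Prop :=
  ∀ (g : G) (x : Q) (v w : TangentSpace 𝓘(ℝ, E) x),
    inner ℝ (mfderiv 𝓘(ℝ, E) 𝓘(ℝ, E) (fun y : Q ↦ g • y) x v)
      (mfderiv 𝓘(ℝ, E) 𝓘(ℝ, E) (fun y : Q ↦ g • y) x w) = inner ℝ v w

variable (G) in
/-- The vector field `X` on `Q` is `G`-equivariant: `T_x Φ_g (X x) = X (Φ_g x)`. -/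
def IsEquivariantField (X : ∀ x : Q, TangentSpace 𝓘(ℝ, E) x) : Prop :=
  ∀ (g : G) (x : Q), mfderiv 𝓘(ℝ, E) 𝓘(ℝ, E) (fun y : Q ↦ g • y) x (X x) = X (g • x)

variable (G) in
/-- `Φ : V → U` is the Riemannian exponential at `q`, restricted to a `G_q`-invariant open
neighbourhood `V = Φ.source` of `0` in `T_q Q` on which `Exp_q` is defined and is a
diffeomorphism onto the open set `U = Φ.target`; its inverse `U → V` is `Log_q`. -/
structure IsInvariantNormalChart [RiemannianBundle (fun x : Q ↦ TangentSpace 𝓘(ℝ, E) x)]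
    (q : Q) (Φ : PartialDiffeomorph 𝓘(ℝ, TangentSpace 𝓘(ℝ, E) q) 𝓘(ℝ, E)
      (TangentSpace 𝓘(ℝ, E) q) Q ∞) : Prop where
  zero_mem : (0 : TangentSpace 𝓘(ℝ, E) q) ∈ Φ.source
  subset_domain : Φ.source ⊆ expDomain q
  eqOn : EqOn (riemannianExp q) Φ Φ.source
  invariant : ∀ h : MulAction.stabilizer G q, ∀ v ∈ Φ.source, isotropyRep E q h v ∈ Φ.source

end Actions

/-! An isometry `h` fixing `q` carries geodesics through `q` to geodesics through `q` and acts on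
their initial velocities by its differential; evaluating at time 1 gives `Exp_q (T_qΦ_h v) = h •
Exp_q v` (`ActsByIsometries.riemannianExp_isotropyRep`). The equivariance claims are formal
consequences: `U = Exp_q(V)` is invariant because `V` is, and differentiating the identity lets the
equivariance of `X` pass through the inverse derivatives of `Exp_q`. The isotropy representation
preserves the Riemannian norm of `T_q Q`, so small balls around `0` are invariant, and existence
reduces to `Exp_q` being a diffeomorphism on arbitrarily small balls.

Two analytic facts remain. First, `Exp_q` does not depend on the chosen geodesic
(`IsUnitTimeGeodesic.apply_one_unique`): geodesics are locally unique as solutions of an ODE in a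
chart, and connectedness of the time interval together with the Hausdorff property makes this
global.

Second, `Exp_q` is smooth near `0` with invertible derivative. A solution of `x' = F(x)`, `x(0) =
p`, on `[-1, 2]` is a preimage of the constant curve `p` under `S x = x - ∫ F ∘ x`, a smooth map on
a Banach space of curves. At an equilibrium whose linearization `N` has square zero, the derivative
of `S` is `1 - T` with `T² = 0`, hence has inverse `1 + T` whatever the length of the interval. The
inverse function theorem then yields all nearby solutions on the whole interval at once, smoothly in
`p`, with time-one derivative `1 + N`. The geodesic spray has such an equilibrium at `(y, 0)`: the
acceleration is quadratic in the velocity, so `N (u, w) = (w, 0)`. The position part of `(1 + N)(0,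
v)` is `v`, so in the preferred chart `Exp_q` has derivative the identity at `0`, and a second use
of the inverse function theorem finishes. -/

/-! ### The inverse function theorem on an open set -/

section InverseFunction

variable {E F : Type*} [NormedAddCommGroup E] [NormedSpace ℝ E] [CompleteSpace E]
  [NormedAddCommGroup F] [NormedSpace ℝ F]

/-- A smooth map on an open set whose derivative at `a` is invertible restricts to a diffeomorphism
near `a`, with smooth inverse on the whole image. -/
theorem ContDiffOn.exists_openPartialHomeomorph {f : E → F} {s : Set E} (hs : IsOpen s)
    (hf : ContDiffOn ℝ ∞ f s) {a : E} (ha : a ∈ s) {f' : E ≃L[ℝ] F}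
    (hf' : HasFDerivAt f (f' : E →L[ℝ] F) a) :
    ∃ φ : OpenPartialHomeomorph E F, a ∈ φ.source ∧ φ.source ⊆ s ∧ (∀ x, φ x = f x) ∧
      ContDiffOn ℝ ∞ φ.symm φ.target := by
  have hat : ∀ x ∈ s, ContDiffAt ℝ ∞ f x := fun x hx ↦ hf.contDiffAt (hs.mem_nhds hx)
  let φ₀ := (hat a ha).toOpenPartialHomeomorph f hf' (by simp)
  have hφ₀ : ∀ x, φ₀ x = f x := fun _ ↦ rfl
  -- The source is cut down to the points where the derivative is invertible, an open condition, so
  -- that the inverse is smooth at every point of the target and not merely at `f a`.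
  let u : Set E := s ∩ fderiv ℝ f ⁻¹' range ((↑) : (E ≃L[ℝ] F) → E →L[ℝ] F)
  have hu : IsOpen u :=
    (hf.continuousOn_fderiv_of_isOpen hs (by simp)).isOpen_inter_preimage hs
      ContinuousLinearEquiv.isOpen
  refine ⟨φ₀.restrOpen u hu, ⟨ContDiffAt.mem_toOpenPartialHomeomorph_source _ _ _, ha, f',
    hf'.fderiv.symm⟩, fun x hx ↦ hx.2.1, hφ₀, fun y hy ↦ ContDiffAt.contDiffWithinAt ?_⟩
  obtain ⟨-, hxs, g, hg⟩ := (φ₀.restrOpen u hu).map_target hy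
  refine OpenPartialHomeomorph.contDiffAt_symm _ (f₀' := g) hy ?_ (hat _ hxs)
  rw [hg]
  exact ((hat _ hxs).differentiableAt (by simp)).hasFDerivAt

end InverseFunction

/-! ### Smoothness of composition operators on spaces of continuous functions -/

namespace ContinuousMap

variable {K : Type*} [TopologicalSpace K] [CompactSpace K]

section Bilinear

variable {W Z : Type*} [NormedAddCommGroup W] [NormedSpace ℝ W]
  [NormedAddCommGroup Z] [NormedSpace ℝ Z]

/-- A shortcut instance: unification of the topologies on `W →L[ℝ] Z` is slow otherwise. -/
noncomputable instance normedAddCommGroupCLM : NormedAddCommGroup C(K, W →L[ℝ] Z) :=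
  ContinuousMap.instNormedAddCommGroup

/-- A shortcut instance. -/
noncomputable instance seminormedAddCommGroupCLM : SeminormedAddCommGroup C(K, W →L[ℝ] Z) :=
  normedAddCommGroupCLM.toSeminormedAddCommGroup

/-- A shortcut instance. -/
noncomputable instance normedSpaceCLM : NormedSpace ℝ C(K, W →L[ℝ] Z) :=
  inferInstance

variable (K W Z) in
/-- Pointwise evaluation of a continuous family of linear maps at a continuous family of vectors. -/
noncomputable def pointwiseApplyL : C(K, W →L[ℝ] Z) →L[ℝ] C(K, W) →L[ℝ] C(K, Z) :=
  LinearMap.mkContinuous₂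
    (LinearMap.mk₂ ℝ (fun A h ↦ ⟨fun t ↦ A t (h t), A.continuous.clm_apply h.continuous⟩)
      (fun _ _ _ ↦ by ext; simp) (fun _ _ _ ↦ by ext; simp)
      (fun _ _ _ ↦ by ext; simp) (fun _ _ _ ↦ by ext; simp)) 1
    fun A h ↦ by
      rw [one_mul]
      refine (ContinuousMap.norm_le _ (by positivity)).2 fun t ↦ ?_
      exact ((A t).le_opNorm _).trans
        (mul_le_mul (A.norm_coe_le_norm t) (h.norm_coe_le_norm t) (norm_nonneg _) (norm_nonneg _))

@[simp]
theorem pointwiseApplyL_apply (A : C(K, W →L[ℝ] Z)) (h : C(K, W)) (t : K) :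
    pointwiseApplyL K W Z A h t = A t (h t) := rfl

/-- At each `t` the mean value inequality bounds the remainder by the oscillation of `fderiv ℝ F`
near `x t`. The bound is uniform in `t` because postcomposition with `fderiv ℝ F` is continuous for
the sup norm. -/
theorem hasFDerivAt_comp {F : W → Z} (hF : ContDiff ℝ 1 F) (x : C(K, W)) :
    HasFDerivAt (fun y : C(K, W) ↦ (⟨F, hF.continuous⟩ : C(W, Z)).comp y)
      (pointwiseApplyL K W Z
        ((⟨fderiv ℝ F, hF.continuous_fderiv one_ne_zero⟩ : C(W, W →L[ℝ] Z)).comp x)) x := by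
  rw [hasFDerivAt_iff_isLittleO_nhds_zero, Asymptotics.isLittleO_iff]
  intro ε hε
  let D : C(W, W →L[ℝ] Z) := ⟨fderiv ℝ F, hF.continuous_fderiv one_ne_zero⟩
  obtain ⟨δ, hδ, hD⟩ := Metric.continuousAt_iff.1
    ((D.continuous_postcomp (X := K)).continuousAt (x := x)) ε hε
  filter_upwards [Metric.ball_mem_nhds (0 : C(K, W)) hδ] with h hh
  rw [mem_ball_zero_iff] at hh
  refine (ContinuousMap.norm_le _ (by positivity)).2 fun t ↦ ?_
  have key := (convex_ball (x t) δ).norm_image_sub_le_of_norm_fderiv_le' (𝕜 := ℝ) (f := F)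
    (φ := fderiv ℝ F (x t)) (C := ε) (x := x t) (y := x t + h t)
    (fun z _ ↦ (hF.differentiable (by simp)) z) (fun z hz ↦ ?_) (Metric.mem_ball_self hδ)
    (by simpa using (h.norm_coe_le_norm t).trans_lt hh)
  · refine le_trans (by simpa using key) ?_
    gcongr
    exact h.norm_coe_le_norm t
  -- Shifting `x` by the constant `z - x t` gives a curve that is uniformly close to `x` and passes
  -- through `z` at `t`; this turns continuity in the sup norm into a bound at the point `z`.
  · have h1 : dist (x + const K (z - x t)) x < δ := by
      rw [dist_eq_norm, add_sub_cancel_left]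
      refine lt_of_le_of_lt ((ContinuousMap.norm_le _ (norm_nonneg (z - x t))).2 fun _ ↦ le_rfl) ?_
      simpa [dist_eq_norm] using hz
    have h2 := (ContinuousMap.dist_apply_le_dist (f := D.comp (x + const K (z - x t)))
      (g := D.comp x) t).trans (hD h1).le
    simpa [D, dist_eq_norm] using h2

end Bilinear

universe u

/-- The derivative is again a composition operator, with `fderiv ℝ F` in place of `F`, followed by a
continuous linear map; hence the induction. It changes the target space to `W →L[ℝ] Z`, so the
spaces are quantified inside the statement and share one universe. -/
theorem contDiff_comp_nat (n : ℕ) : ∀ {W Z : Type u} [NormedAddCommGroup W] [NormedSpace ℝ W]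
    [NormedAddCommGroup Z] [NormedSpace ℝ Z] {F : W → Z} (hF : ContDiff ℝ n F),
    ContDiff ℝ n (fun y : C(K, W) ↦ (⟨F, hF.continuous⟩ : C(W, Z)).comp y) := by
  induction n with
  | zero =>
    intro W Z _ _ _ _ F hF
    exact contDiff_zero.2 (continuous_postcomp _)
  | succ n ih =>
    intro W Z _ _ _ _ F hF
    have h1 : ContDiff ℝ 1 F := hF.of_le (by norm_cast; omega)
    have h2 : ContDiff ℝ n (fderiv ℝ F) := hF.fderiv_right (by norm_cast)
    exact contDiff_succ_iff_hasFDerivAt.2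
      ⟨_, (pointwiseApplyL K W Z).contDiff.comp (ih h2), fun x ↦ hasFDerivAt_comp h1 x⟩

theorem contDiff_comp {W Z : Type u} [NormedAddCommGroup W] [NormedSpace ℝ W]
    [NormedAddCommGroup Z] [NormedSpace ℝ Z] {F : W → Z} (hF : ContDiff ℝ ∞ F) :
    ContDiff ℝ ∞ (fun y : C(K, W) ↦ (⟨F, hF.continuous⟩ : C(W, Z)).comp y) :=
  contDiff_infty.2 fun n ↦ contDiff_comp_nat n (hF.of_le (by exact_mod_cast le_top))

end ContinuousMap

/-! ### Smooth dependence of solutions on initial values near a nilpotent equilibrium -/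

section Flow

variable {W : Type*} [NormedAddCommGroup W]

/-- Curves live on `[-1, 2]` so that `0` and `1` are interior times and the open interval `(-1, 2)`
contains `[0, 1]`. -/
theorem zero_mem_Icc_neg_one_two : (0 : ℝ) ∈ Icc (-1 : ℝ) 2 := by norm_num
theorem one_mem_Icc_neg_one_two : (1 : ℝ) ∈ Icc (-1 : ℝ) 2 := by norm_num

/-- The extension of a curve on `[-1, 2]` to the real line that is constant on each side. -/
noncomputable def extendCurve (x : C(Icc (-1 : ℝ) 2, W)) (t : ℝ) : W :=
  x (projIcc (-1) 2 (by norm_num) t)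

theorem continuous_extendCurve (x : C(Icc (-1 : ℝ) 2, W)) : Continuous (extendCurve x) :=
  x.continuous.comp continuous_projIcc

theorem extendCurve_of_mem (x : C(Icc (-1 : ℝ) 2, W)) {t : ℝ} (ht : t ∈ Icc (-1 : ℝ) 2) :
    extendCurve x t = x ⟨t, ht⟩ := by
  rw [extendCurve, projIcc_of_mem]

theorem intervalIntegrable_extendCurve (x : C(Icc (-1 : ℝ) 2, W)) (a b : ℝ) :
    IntervalIntegrable (extendCurve x) MeasureTheory.volume a b :=
  (continuous_extendCurve x).intervalIntegrable a b

variable [NormedSpace ℝ W]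

variable (W) in
/-- The primitive vanishing at `0` of a curve on `[-1, 2]`. -/
noncomputable def primitiveL : C(Icc (-1 : ℝ) 2, W) →L[ℝ] C(Icc (-1 : ℝ) 2, W) :=
  LinearMap.mkContinuous
    { toFun := fun x ↦ ⟨fun t ↦ ∫ s in (0 : ℝ)..t, extendCurve x s,
        (intervalIntegral.continuous_primitive (intervalIntegrable_extendCurve x) 0).comp
          continuous_subtype_val⟩
      map_add' := fun x y ↦ by
        ext t
        exact intervalIntegral.integral_add (intervalIntegrable_extendCurve x _ _)
          (intervalIntegrable_extendCurve y _ _)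
      map_smul' := fun c x ↦ by
        ext t
        exact intervalIntegral.integral_smul c (extendCurve x) } 2
    fun x ↦ (ContinuousMap.norm_le _ (by positivity)).2 fun t ↦ by
      refine (intervalIntegral.norm_integral_le_of_norm_le_const (C := ‖x‖)
        fun s _ ↦ x.norm_coe_le_norm _).trans ?_
      rw [mul_comm, sub_zero]
      gcongr
      exact abs_le.2 ⟨by linarith [t.2.1], t.2.2⟩

variable [CompleteSpace W]

theorem map_primitiveL (N : W →L[ℝ] W) (x : C(Icc (-1 : ℝ) 2, W)) (t : Icc (-1 : ℝ) 2) :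
    N (primitiveL W x t) = ∫ s in (0 : ℝ)..t, N (extendCurve x s) :=
  (N.intervalIntegral_comp_comm (intervalIntegrable_extendCurve x _ _)).symm

/-- Solutions on `[-1, 2]` of the integral equation of a globally defined smooth field depend
smoothly on the initial value, near an equilibrium at which the linearization has square zero. -/
theorem exists_contDiffOn_integral_solution {F : W → W} (hF : ContDiff ℝ ∞ F) {p₀ : W}
    (h₀ : F p₀ = 0) (hN : ∀ w, fderiv ℝ F p₀ (fderiv ℝ F p₀ w) = 0) :
    ∃ (O : Set W) (σ : W → C(Icc (-1 : ℝ) 2, W)), IsOpen O ∧ p₀ ∈ O ∧ ContDiffOn ℝ ∞ σ O ∧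
      σ p₀ = ContinuousMap.const _ p₀ ∧
      (∀ p ∈ O, ∀ t : Icc (-1 : ℝ) 2, σ p t = p + ∫ s in (0 : ℝ)..t, F (extendCurve (σ p) s)) ∧
      HasFDerivAt (fun p ↦ σ p ⟨1, one_mem_Icc_neg_one_two⟩)
        (ContinuousLinearMap.id ℝ W + fderiv ℝ F p₀) p₀ := by
  set N := fderiv ℝ F p₀ with hNdef
  let x₀ : C(Icc (-1 : ℝ) 2, W) := ContinuousMap.const _ p₀
  let Fc : C(W, W) := ⟨F, hF.continuous⟩
  -- Solutions with initial value `p` are exactly the curves that `S` sends to the constant `p`.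
  let S : C(Icc (-1 : ℝ) 2, W) → C(Icc (-1 : ℝ) 2, W) := fun x ↦ x - primitiveL W (Fc.comp x)
  have hS : ContDiff ℝ ∞ S :=
    contDiff_id.sub ((primitiveL W).contDiff.comp (ContinuousMap.contDiff_comp hF))
  let T : C(Icc (-1 : ℝ) 2, W) →L[ℝ] C(Icc (-1 : ℝ) 2, W) :=
    (primitiveL W).comp (ContinuousMap.pointwiseApplyL _ W W (ContinuousMap.const _ N))
  have hTT : ∀ h, T (T h) = 0 := by
    intro h
    ext t
    -- `N` passes under the integral that defines `T h`, where it meets the `N` already there, and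
    -- `N² = 0`.
    have : ∀ s : ℝ, N (extendCurve (T h) s) = 0 := by
      intro s
      simp only [extendCurve, T, ContinuousLinearMap.comp_apply, map_primitiveL]
      simp [hN]
    change ∫ s in (0 : ℝ)..t, N (extendCurve (T h) s) = 0
    simp [this]
  let e : C(Icc (-1 : ℝ) 2, W) ≃L[ℝ] C(Icc (-1 : ℝ) 2, W) :=
    ContinuousLinearEquiv.equivOfInverse (ContinuousLinearMap.id ℝ _ - T)
      (ContinuousLinearMap.id ℝ _ + T) (fun h ↦ by simp [hTT]) (fun h ↦ by simp [hTT])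
  have hSe : HasFDerivAt S (e : C(Icc (-1 : ℝ) 2, W) →L[ℝ] C(Icc (-1 : ℝ) 2, W)) x₀ :=
    (hasFDerivAt_id x₀).sub ((primitiveL W).hasFDerivAt.comp x₀
      (ContinuousMap.hasFDerivAt_comp (hF.of_le (by simp)) x₀))
  have hSx₀ : S x₀ = x₀ := by
    ext t
    change p₀ - ∫ s in (0 : ℝ)..t, F p₀ = p₀
    simp [h₀]
  obtain ⟨φ, hφ, -, hφS, hφsymm⟩ :=
    hS.contDiffOn.exists_openPartialHomeomorph isOpen_univ (mem_univ x₀) hSe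
  let cst : W →L[ℝ] C(Icc (-1 : ℝ) 2, W) := ContinuousLinearMap.const ℝ _
  have hx₀t : x₀ ∈ φ.target := by
    have := φ.map_source hφ
    rwa [hφS, hSx₀] at this
  have hsx₀ : φ.symm x₀ = x₀ := by
    have := φ.left_inv hφ
    rwa [hφS, hSx₀] at this
  refine ⟨cst ⁻¹' φ.target, fun p ↦ φ.symm (cst p), φ.open_target.preimage cst.continuous, hx₀t,
    hφsymm.comp cst.contDiff.contDiffOn (fun _ h ↦ h), hsx₀, fun p hp t ↦ ?_, ?_⟩
  · have h1 := φ.right_inv hp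
    rw [hφS] at h1
    have h2 := DFunLike.congr_fun h1 t
    change φ.symm (cst p) t - ∫ s in (0 : ℝ)..t, F (extendCurve (φ.symm (cst p)) s) = p at h2
    exact sub_eq_iff_eq_add.1 h2
  -- The inverse of `1 - T` is `1 + T`; applied to a constant curve `w` and evaluated at time `1` it
  -- gives `w + N w`.
  · have h1 : HasFDerivAt φ.symm
        (e.symm : C(Icc (-1 : ℝ) 2, W) →L[ℝ] C(Icc (-1 : ℝ) 2, W)) x₀ := by
      refine φ.hasFDerivAt_symm hx₀t ?_
      rw [hsx₀]
      exact hSe.congr_of_eventuallyEq (Filter.Eventually.of_forall hφS)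
    have h2 := (ContinuousMap.evalCLM ℝ
      (⟨1, one_mem_Icc_neg_one_two⟩ : Icc (-1 : ℝ) 2)).hasFDerivAt.comp p₀
        (HasFDerivAt.comp p₀ (g := φ.symm) (f := cst) h1 cst.hasFDerivAt)
    refine h2.congr_fderiv ?_
    ext w
    change w + ∫ s in (0 : ℝ)..1, N w = w + N w
    simp

/-- A smooth vector field on an open set has, near an equilibrium at which its linearization `N`
has square zero, integral curves on `(-1, 2)` whose value at time `1` depends smoothly on the initial
value, with derivative `1 + N` at the equilibrium. -/
theorem exists_contDiffOn_timeOne [FiniteDimensional ℝ W] {F : W → W} {s : Set W} (hs : IsOpen s)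
    (hF : ContDiffOn ℝ ∞ F s) {p₀ : W} (hp₀ : p₀ ∈ s)
    (h₀ : F p₀ = 0) (hN : ∀ w, fderiv ℝ F p₀ (fderiv ℝ F p₀ w) = 0) :
    ∃ (O : Set W) (x : W → ℝ → W), IsOpen O ∧ p₀ ∈ O ∧ ContDiffOn ℝ ∞ (fun p ↦ x p 1) O ∧
      HasFDerivAt (fun p ↦ x p 1) (ContinuousLinearMap.id ℝ W + fderiv ℝ F p₀) p₀ ∧
      ∀ p ∈ O, x p 0 = p ∧ ∀ t ∈ Ioo (-1 : ℝ) 2, x p t ∈ s ∧ HasDerivAt (x p) (F (x p t)) t := by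
  obtain ⟨r, hr, hrs⟩ := Metric.nhds_basis_closedBall.mem_iff.1 (hs.mem_nhds hp₀)
  -- Cutting the field off outside a ball inside `s` makes it globally smooth without changing it on
  -- the ball of radius `r / 2`.
  let χ : ContDiffBump p₀ := ⟨r / 2, r, by positivity, by linarith⟩
  let F' : W → W := fun w ↦ χ w • F w
  have hF' : ContDiff ℝ ∞ F' := by
    refine contDiff_iff_contDiffAt.2 fun w ↦ ?_
    by_cases hw : w ∈ s
    · exact χ.contDiffAt.smul (hF.contDiffAt (hs.mem_nhds hw))
    · have : F' =ᶠ[𝓝 w] fun _ ↦ 0 := by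
        have hc : w ∉ Metric.closedBall p₀ r := fun h ↦ hw (hrs h)
        filter_upwards [Metric.isClosed_closedBall.isOpen_compl.mem_nhds hc] with z hz
        have : χ z = 0 := χ.zero_of_le_dist (not_le.1 (show ¬ dist z p₀ ≤ r from hz)).le
        simp [F', this]
      exact contDiffAt_const.congr_of_eventuallyEq this
  have hFF' : ∀ w ∈ Metric.ball p₀ (r / 2), F' w = F w := fun w hw ↦ by
    simp [F', χ.one_of_mem_closedBall (Metric.ball_subset_closedBall hw)]
  have hder : fderiv ℝ F' p₀ = fderiv ℝ F p₀ :=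
    Filter.EventuallyEq.fderiv_eq
      (Filter.eventuallyEq_of_mem (Metric.ball_mem_nhds p₀ (by positivity)) hFF')
  obtain ⟨O, σ, hO, hpO, hσ, hσ₀, hsol, hσ'⟩ := exists_contDiffOn_integral_solution hF'
    (by rw [hFF' p₀ (Metric.mem_ball_self (by positivity)), h₀]) (by rwa [hder])
  -- Initial values are restricted to those whose whole solution stays within `r / 2` of `p₀`, where
  -- the cut-off field is the original one.
  refine ⟨O ∩ σ ⁻¹' Metric.ball (σ p₀) (r / 2), fun p ↦ extendCurve (σ p),
    hσ.continuousOn.isOpen_inter_preimage hO Metric.isOpen_ball,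
    ⟨hpO, Metric.mem_ball_self (by positivity)⟩, ?_, ?_, fun p hp ↦ ⟨?_, fun t ht ↦ ?_⟩⟩
  · simp only [extendCurve_of_mem _ one_mem_Icc_neg_one_two]
    exact (ContinuousMap.evalCLM ℝ _).contDiff.comp_contDiffOn (hσ.mono inter_subset_left)
  · simp only [extendCurve_of_mem _ one_mem_Icc_neg_one_two]
    rwa [← hder]
  · dsimp only
    rw [extendCurve_of_mem _ zero_mem_Icc_neg_one_two, hsol p hp.1]
    simp
  · have hball : ∀ t, extendCurve (σ p) t ∈ Metric.ball p₀ (r / 2) := fun t ↦ by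
      have := (ContinuousMap.dist_apply_le_dist (f := σ p) (g := σ p₀)
        (projIcc (-1) 2 (by norm_num) t)).trans_lt hp.2
      rwa [hσ₀] at this
    have hc : Continuous fun t ↦ F' (extendCurve (σ p) t) :=
      hF'.continuous.comp (continuous_extendCurve _)
    refine ⟨hrs (Metric.ball_subset_closedBall (Metric.ball_subset_ball (by linarith) (hball t))),
      ?_⟩
    rw [← hFF' _ (hball t)]
    have h1 : HasDerivAt (fun t ↦ p + ∫ s in (0 : ℝ)..t, F' (extendCurve (σ p) s))
        (F' (extendCurve (σ p) t)) t :=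
      (intervalIntegral.integral_hasDerivAt_right (hc.intervalIntegrable _ _)
        (hc.stronglyMeasurableAtFilter _ _) hc.continuousAt).const_add p
    refine h1.congr_of_eventuallyEq ?_
    filter_upwards [Ioo_mem_nhds ht.1 ht.2] with τ hτ
    rw [extendCurve_of_mem _ (Ioo_subset_Icc_self hτ), hsol p hp.1]

end Flow

/-! ### The geodesic equation of a metric on an open subset of a vector space -/

section VectorSpaceGeodesic

variable {E : Type*} [NormedAddCommGroup E] [NormedSpace ℝ E]

/-- A shortcut instance for the space of bilinear forms. -/
noncomputable instance normedAddCommGroupBilinForm : NormedAddCommGroup (E →L[ℝ] E →L[ℝ] ℝ) :=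
  ContinuousLinearMap.toNormedAddCommGroup

/-- A shortcut instance for the space of bilinear forms. -/
noncomputable instance normedSpaceBilinForm : NormedSpace ℝ (E →L[ℝ] E →L[ℝ] ℝ) :=
  ContinuousLinearMap.toNormedSpace

/-- A shortcut instance for the space of trilinear forms. -/
noncomputable instance normedAddCommGroupTrilinForm :
    NormedAddCommGroup (E →L[ℝ] E →L[ℝ] E →L[ℝ] ℝ) :=
  ContinuousLinearMap.toNormedAddCommGroup

/-- A shortcut instance for the space of trilinear forms. -/
noncomputable instance normedSpaceTrilinForm : NormedSpace ℝ (E →L[ℝ] E →L[ℝ] E →L[ℝ] ℝ) :=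
  ContinuousLinearMap.toNormedSpace

/-- The quadratic form `w ↦ ∂_v g(v, w) - ∂_w g(v, v) / 2` of the Christoffel symbols of the first
kind of the metric `g` at `y`. -/
noncomputable def christoffelForm (g : E → E →L[ℝ] E →L[ℝ] ℝ) (y v : E) : E →L[ℝ] ℝ :=
  fderiv ℝ g y v v - (2⁻¹ : ℝ) • ((fderiv ℝ g y).flip v).flip v

theorem christoffelForm_apply (g : E → E →L[ℝ] E →L[ℝ] ℝ) (y v w : E) :
    christoffelForm g y v w = fderiv ℝ g y v v w - 2⁻¹ * fderiv ℝ g y w v v := rfl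

/-- The acceleration prescribed by the geodesic equation at position `p.1` and velocity `p.2`. -/
noncomputable def geodesicAccel (g : E → E →L[ℝ] E →L[ℝ] ℝ) (p : E × E) : E :=
  -(g p.1).inverse (christoffelForm g p.1 p.2)

theorem geodesicAccel_smul (g : E → E →L[ℝ] E →L[ℝ] ℝ) (y v : E) (t : ℝ) :
    geodesicAccel g (y, t • v) = (t * t) • geodesicAccel g (y, v) := by
  have : christoffelForm g y (t • v) = (t * t) • christoffelForm g y v := by
    ext w
    simp [christoffelForm_apply]
    ring
  simp [geodesicAccel, this]

theorem geodesicAccel_zero (g : E → E →L[ℝ] E →L[ℝ] ℝ) (y : E) : geodesicAccel g (y, 0) = 0 := by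
  simpa using geodesicAccel_smul g y 0 0

/-- The geodesic spray of `g` as a first order system on positions and velocities. -/
noncomputable def geodesicSpray (g : E → E →L[ℝ] E →L[ℝ] ℝ) (p : E × E) : E × E :=
  (p.2, geodesicAccel g p)

/-- The geodesic equation under a change of coordinates `ψ`. -/
theorem geodesic_equation_change_of_coordinates {g₁ g₂ : E → E →L[ℝ] E →L[ℝ] ℝ} {ψ : E → E}
    {c : ℝ → E} {t : ℝ} (hψ : ContDiffAt ℝ 2 ψ (c t)) (hc : ContDiffAt ℝ 2 c t)
    (hg₁ : DifferentiableAt ℝ g₁ (ψ (c t))) (hg₂ : DifferentiableAt ℝ g₂ (c t))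
    (hsymm : ∀ u w, g₁ (ψ (c t)) u w = g₁ (ψ (c t)) w u)
    (hg : ∀ᶠ z in 𝓝 (c t), ∀ u w, g₂ z u w = g₁ (ψ z) (fderiv ℝ ψ z u) (fderiv ℝ ψ z w)) (w : E) :
    g₂ (c t) (deriv (deriv c) t) w + christoffelForm g₂ (c t) (deriv c t) w =
      g₁ (ψ (c t)) (deriv (deriv fun s ↦ ψ (c s)) t) (fderiv ℝ ψ (c t) w) +
        christoffelForm g₁ (ψ (c t)) (deriv (fun s ↦ ψ (c s)) t) (fderiv ℝ ψ (c t) w) := by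
  have hψd : DifferentiableAt ℝ ψ (c t) := hψ.differentiableAt (by simp)
  have hψ' : DifferentiableAt ℝ (fderiv ℝ ψ) (c t) :=
    (hψ.fderiv_right (m := 1) (by norm_num)).differentiableAt (by simp)
  have hcd : DifferentiableAt ℝ c t := hc.differentiableAt (by simp)
  have hc1 : ContDiffAt ℝ 1 (deriv c) t := by
    have := (hc.fderiv_right (m := 1) (by norm_num)).clm_apply
      (contDiffAt_const (c := (1 : ℝ)))
    simpa only [fderiv_apply_one_eq_deriv] using this
  set D := fderiv ℝ ψ (c t) with hD
  set D₂ := fderiv ℝ (fderiv ℝ ψ) (c t) with hD₂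
  have hD₂symm : ∀ a b, D₂ a b = D₂ b a := fun a b ↦
    (hψ.isSymmSndFDerivAt (by simp)) a b
  have hder : ∀ u a b, fderiv ℝ g₂ (c t) u a b =
      fderiv ℝ g₁ (ψ (c t)) (D u) (D a) (D b) + g₁ (ψ (c t)) (D₂ u a) (D b) +
        g₁ (ψ (c t)) (D a) (D₂ u b) := by
    intro u a b
    have h2 : HasFDerivAt (fun z ↦ g₂ z a b) _ (c t) :=
      (hg₂.hasFDerivAt.clm_apply (hasFDerivAt_const a _)).clm_apply (hasFDerivAt_const b _)
    have h1 : HasFDerivAt (fun z ↦ g₁ (ψ z) (fderiv ℝ ψ z a) (fderiv ℝ ψ z b)) _ (c t) :=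
      ((hg₁.hasFDerivAt.comp (c t) hψd.hasFDerivAt).clm_apply
        (hψ'.hasFDerivAt.clm_apply (hasFDerivAt_const a _))).clm_apply
        (hψ'.hasFDerivAt.clm_apply (hasFDerivAt_const b _))
    have h := DFunLike.congr_fun
      (h2.unique (h1.congr_of_eventuallyEq (hg.mono fun z hz ↦ hz a b))) u
    simp at h
    rw [h]
    ring
  have hd1 : deriv (fun s ↦ ψ (c s)) =ᶠ[𝓝 t] fun s ↦ fderiv ℝ ψ (c s) (deriv c s) := by
    have e1 : ∀ᶠ s in 𝓝 t, DifferentiableAt ℝ ψ (c s) :=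
      hcd.continuousAt.eventually ((hψ.eventually (by simp)).mono
        fun z hz ↦ hz.differentiableAt (by simp))
    have e2 : ∀ᶠ s in 𝓝 t, DifferentiableAt ℝ c s :=
      (hc.eventually (by simp)).mono fun z hz ↦ hz.differentiableAt (by simp)
    filter_upwards [e1, e2] with s h1 h2
    exact fderiv_comp_deriv s h1 h2
  have hd2 : deriv (deriv fun s ↦ ψ (c s)) t =
      D₂ (deriv c t) (deriv c t) + D (deriv (deriv c) t) := by
    rw [hd1.deriv_eq]
    have h1 : HasDerivAt (fun s ↦ fderiv ℝ ψ (c s)) (D₂ (deriv c t)) t :=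
      hψ'.hasFDerivAt.comp_hasDerivAt t hcd.hasDerivAt
    exact (h1.clm_apply (hc1.differentiableAt (by simp)).hasDerivAt).deriv
  rw [hd2, hd1.eq_of_nhds, ← hD, christoffelForm_apply, christoffelForm_apply, hder, hder,
    hg.self_of_nhds, ← hD]
  simp only [map_add, add_apply]
  -- By symmetry of the second derivative and of the metric, the two terms `g₁(D₂(w, c'), D c')`
  -- with factor `1/2` cancel `g₁(D c', D₂(c', w))`; the surviving term `g₁(D₂(c', c'), D w)` is the
  -- one produced by `(ψ ∘ c)''`.
  rw [hD₂symm w, hsymm (D₂ (deriv c t) w)]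
  ring

variable [FiniteDimensional ℝ E] {g : E → E →L[ℝ] E →L[ℝ] ℝ}

/-- Positivity forces a trivial kernel, and `E` and its dual have the same dimension. This is what
allows the geodesic equation to be solved for the second derivative. -/
theorem exists_continuousLinearEquiv_of_pos {b : E →L[ℝ] E →L[ℝ] ℝ}
    (hb : ∀ u, u ≠ 0 → 0 < b u u) :
    ∃ f : E ≃L[ℝ] (E →L[ℝ] ℝ), (f : E →L[ℝ] E →L[ℝ] ℝ) = b := by
  have hinj : Function.Injective b.toLinearMap := by
    rw [← LinearMap.ker_eq_bot, LinearMap.ker_eq_bot']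
    intro u hu
    by_contra hne
    have := hb u hne
    rw [show b u = 0 from hu] at this
    simp at this
  have hrank : Module.finrank ℝ E = Module.finrank ℝ (E →L[ℝ] ℝ) := by
    rw [← LinearMap.toContinuousLinearMap.finrank_eq]
    exact Subspace.dual_finrank_eq.symm
  refine ⟨(LinearEquiv.ofInjectiveOfFinrankEq b.toLinearMap hinj hrank).toContinuousLinearEquiv, ?_⟩
  ext u w
  rfl

theorem geodesicAccel_eq_iff {y v a : E} (hy : ∀ u, u ≠ 0 → 0 < g y u u) :
    (∀ w, g y a w + christoffelForm g y v w = 0) ↔ a = geodesicAccel g (y, v) := by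
  obtain ⟨f, hf⟩ := exists_continuousLinearEquiv_of_pos hy
  have : (∀ w, g y a w + christoffelForm g y v w = 0) ↔ f a = -christoffelForm g y v := by
    rw [ContinuousLinearMap.ext_iff]
    refine forall_congr' fun w ↦ ?_
    rw [← hf, add_eq_zero_iff_eq_neg]
    rfl
  rw [this, geodesicAccel, ← hf, ContinuousLinearMap.inverse_equiv]
  simp only [ContinuousLinearEquiv.coe_coe]
  rw [← map_neg, ContinuousLinearEquiv.eq_symm_apply]

variable {s : Set E}

theorem contDiffOn_geodesicSpray (hs : IsOpen s) (hg : ContDiffOn ℝ ∞ g s)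
    (hpos : ∀ y ∈ s, ∀ u, u ≠ 0 → 0 < g y u u) :
    ContDiffOn ℝ ∞ (geodesicSpray g) (s ×ˢ univ) := by
  have h1 : ContDiffOn ℝ ∞ (fun p : E × E ↦ g p.1) (s ×ˢ univ) :=
    hg.comp contDiffOn_fst fun p hp ↦ hp.1
  have h2 : ContDiffOn ℝ ∞ (fun p : E × E ↦ fderiv ℝ g p.1) (s ×ˢ univ) :=
    (hg.fderiv_of_isOpen hs (m := ∞) (by simp)).comp contDiffOn_fst fun p hp ↦ hp.1
  have h3 : ContDiffOn ℝ ∞ (fun p : E × E ↦ christoffelForm g p.1 p.2) (s ×ˢ univ) := by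
    refine contDiffOn_clm_apply.2 fun w ↦ ?_
    simp only [christoffelForm_apply]
    exact (((h2.clm_apply contDiffOn_snd).clm_apply contDiffOn_snd).clm_apply
      contDiffOn_const).sub (contDiffOn_const.mul
        (((h2.clm_apply contDiffOn_const).clm_apply contDiffOn_snd).clm_apply contDiffOn_snd))
  refine contDiffOn_snd.prodMk (ContDiffOn.neg (ContDiffOn.clm_apply ?_ h3))
  intro p hp
  obtain ⟨f, hf⟩ := exists_continuousLinearEquiv_of_pos (hpos p.1 hp.1)
  have := contDiffAt_map_inverse (𝕜 := ℝ) (n := ∞) f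
  rw [hf] at this
  exact this.comp_contDiffWithinAt p (h1 p hp)

/-- The acceleration vanishes at zero velocity and is quadratic in the velocity, so it contributes
nothing to first order. The resulting linearization has square zero, as `exists_contDiffOn_timeOne`
requires. -/
theorem fderiv_geodesicSpray (hs : IsOpen s) (hg : ContDiffOn ℝ ∞ g s)
    (hpos : ∀ y ∈ s, ∀ u, u ≠ 0 → 0 < g y u u) {y : E} (hy : y ∈ s) (p : E × E) :
    fderiv ℝ (geodesicSpray g) (y, 0) p = (p.2, 0) := by
  have hd : DifferentiableAt ℝ (geodesicSpray g) (y, 0) :=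
    ((contDiffOn_geodesicSpray hs hg hpos).contDiffAt
      ((hs.prod isOpen_univ).mem_nhds ⟨hy, mem_univ _⟩)).differentiableAt (by simp)
  have hline : ∀ q q' : E × E, HasDerivAt (fun t : ℝ ↦ geodesicSpray g ((y, 0) + t • q)) q' 0 →
      fderiv ℝ (geodesicSpray g) (y, 0) q = q' := fun q q' h ↦ by
    have := (hd.hasFDerivAt.hasLineDerivAt q)
    exact this.unique h
  have h1 : fderiv ℝ (geodesicSpray g) (y, 0) (p.1, 0) = 0 := by
    refine hline _ _ ?_
    simp only [geodesicSpray, Prod.smul_mk, smul_zero, Prod.mk_add_mk, add_zero,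
      geodesicAccel_zero]
    exact hasDerivAt_const (0 : ℝ) (0 : E × E)
  have h2 : fderiv ℝ (geodesicSpray g) (y, 0) (0, p.2) = (p.2, 0) := by
    refine hline _ _ ?_
    simp only [geodesicSpray, Prod.smul_mk, smul_zero, Prod.mk_add_mk, add_zero, zero_add,
      geodesicAccel_smul]
    refine HasDerivAt.prodMk ?_ ?_
    · simpa using (hasDerivAt_id (0 : ℝ)).smul_const p.2
    · simpa using ((hasDerivAt_id (0 : ℝ)).mul (hasDerivAt_id (0 : ℝ))).smul_const
        (geodesicAccel g (y, p.2))
  have : p = (p.1, 0) + (0, p.2) := by simp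
  rw [this, map_add, h1, h2]
  simp

/-- Local uniqueness for the geodesic equation. -/
theorem geodesic_equation_eventuallyEq (hs : IsOpen s) (hg : ContDiffOn ℝ ∞ g s)
    (hpos : ∀ y ∈ s, ∀ u, u ≠ 0 → 0 < g y u u) {c₁ c₂ : ℝ → E} {t : ℝ}
    (h₁ : ContDiffAt ℝ 2 c₁ t) (h₂ : ContDiffAt ℝ 2 c₂ t)
    (e₁ : ∀ᶠ τ in 𝓝 t, deriv (deriv c₁) τ = geodesicAccel g (c₁ τ, deriv c₁ τ))
    (e₂ : ∀ᶠ τ in 𝓝 t, deriv (deriv c₂) τ = geodesicAccel g (c₂ τ, deriv c₂ τ))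
    (ht : c₁ t ∈ s) (heq : c₁ t = c₂ t) (hderiv : deriv c₁ t = deriv c₂ t) : c₁ =ᶠ[𝓝 t] c₂ := by
  have hF : ContDiffAt ℝ 1 (geodesicSpray g) (c₁ t, deriv c₁ t) :=
    ((contDiffOn_geodesicSpray hs hg hpos).contDiffAt
      ((hs.prod isOpen_univ).mem_nhds ⟨ht, mem_univ _⟩)).of_le (by simp)
  obtain ⟨K, S, hS, hK⟩ := hF.exists_lipschitzOnWith
  -- Position and velocity together solve the first order system of the spray and stay in a set on
  -- which the spray is Lipschitz, so ODE uniqueness applies.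
  have key : ∀ c : ℝ → E, ContDiffAt ℝ 2 c t →
      (∀ᶠ τ in 𝓝 t, deriv (deriv c) τ = geodesicAccel g (c τ, deriv c τ)) →
      c t = c₁ t → deriv c t = deriv c₁ t → ∀ᶠ τ in 𝓝 t,
        HasDerivAt (fun τ ↦ (c τ, deriv c τ)) (geodesicSpray g (c τ, deriv c τ)) τ ∧
          (c τ, deriv c τ) ∈ S := by
    intro c hc he h0 h1
    have hd : ∀ᶠ τ in 𝓝 t, ContDiffAt ℝ 1 (deriv c) τ := by
      filter_upwards [hc.eventually (by simp)] with τ hτ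
      have := (hτ.fderiv_right (m := 1) (by norm_num)).clm_apply
        (contDiffAt_const (c := (1 : ℝ)))
      simpa only [fderiv_apply_one_eq_deriv] using this
    have hcont : ContinuousAt (fun τ ↦ (c τ, deriv c τ)) t :=
      hc.continuousAt.prodMk hd.self_of_nhds.continuousAt
    have hmem : ∀ᶠ τ in 𝓝 t, (c τ, deriv c τ) ∈ S := by
      refine hcont.eventually ?_
      simp only [h0, h1]
      exact hS
    filter_upwards [hc.eventually (by simp), hd, he, hmem] with τ a1 a2 a3 a4
    refine ⟨(a1.differentiableAt (by simp)).hasDerivAt.prodMk ?_, a4⟩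
    rw [← a3]
    exact (a2.differentiableAt (by simp)).hasDerivAt
  have := ODE_solution_unique_of_eventually (v := fun _ ↦ geodesicSpray g) (s := fun _ ↦ S)
    (Filter.Eventually.of_forall fun _ ↦ hK) (key c₁ h₁ e₁ rfl rfl)
    (key c₂ h₂ e₂ heq.symm hderiv.symm) (by rw [heq, hderiv])
  exact this.mono fun τ hτ ↦ (Prod.ext_iff.1 hτ).1

/-- Geodesics through `y` with small initial velocity `v` exist on `(-1, 2)`, and their position at
time `1` depends smoothly on `v`, with derivative the identity at `v = 0`. -/
theorem exists_geodesic_equation_solution (hs : IsOpen s) (hg : ContDiffOn ℝ ∞ g s)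
    (hpos : ∀ y ∈ s, ∀ u, u ≠ 0 → 0 < g y u u) {y : E} (hy : y ∈ s) :
    ∃ (O : Set E) (c : E → ℝ → E), IsOpen O ∧ (0 : E) ∈ O ∧ ContDiffOn ℝ ∞ (fun v ↦ c v 1) O ∧
      HasFDerivAt (fun v ↦ c v 1) (ContinuousLinearMap.id ℝ E) 0 ∧
      ∀ v ∈ O, c v 0 = y ∧ deriv (c v) 0 = v ∧ ∀ t ∈ Ioo (-1 : ℝ) 2, c v t ∈ s ∧
        ContDiffAt ℝ 2 (c v) t ∧ deriv (deriv (c v)) t = geodesicAccel g (c v t, deriv (c v) t) := by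
  have hF := contDiffOn_geodesicSpray hs hg hpos
  have hd := fderiv_geodesicSpray hs hg hpos hy
  obtain ⟨O, x, hO, hyO, hx, hx', hsol⟩ := exists_contDiffOn_timeOne (hs.prod isOpen_univ) hF
    (p₀ := (y, 0)) ⟨hy, mem_univ _⟩ (by simp [geodesicSpray, geodesicAccel_zero])
    (fun w ↦ by simp [hd])
  let ι : E → E × E := fun v ↦ (y, v)
  have hι : ContDiff ℝ ∞ ι := contDiff_const.prodMk contDiff_id
  have hmaps : MapsTo ι (ι ⁻¹' O) O := fun _ h ↦ h
  refine ⟨ι ⁻¹' O, fun v t ↦ (x (y, v) t).1, hO.preimage hι.continuous, hyO,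
    contDiff_fst.comp_contDiffOn (hx.comp hι.contDiffOn hmaps), ?_, fun v hv ↦ ?_⟩
  · have h1 : HasFDerivAt ι (ContinuousLinearMap.inr ℝ E E) 0 :=
      (hasFDerivAt_const y 0).prodMk (hasFDerivAt_id 0)
    have h2 := hasFDerivAt_fst.comp (0 : E) (HasFDerivAt.comp (0 : E) (g := fun p ↦ x p 1) hx' h1)
    refine h2.congr_fderiv ?_
    ext v
    simp [hd]
  · obtain ⟨h0, hv⟩ := hsol _ hv
    have hc : ∀ t ∈ Ioo (-1 : ℝ) 2, HasDerivAt (fun t ↦ (x (y, v) t).1) (x (y, v) t).2 t :=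
      fun t ht ↦ (hv t ht).2.fst
    have hc' : ∀ t ∈ Ioo (-1 : ℝ) 2, HasDerivAt (fun t ↦ (x (y, v) t).2)
        (geodesicAccel g (x (y, v) t)) t := fun t ht ↦ (hv t ht).2.snd
    have hderiv : EqOn (deriv fun t ↦ (x (y, v) t).1) (fun t ↦ (x (y, v) t).2) (Ioo (-1) 2) :=
      fun t ht ↦ (hc t ht).deriv
    -- Regularity is bootstrapped: the phase curve is `C¹` because its derivative is the spray along
    -- it, and the position is then `C²` because its derivative is the velocity component.
    have hcont : ContDiffOn ℝ 1 (x (y, v)) (Ioo (-1) 2) := by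
      have hdo : DifferentiableOn ℝ (x (y, v)) (Ioo (-1) 2) := fun t ht ↦
        (hv t ht).2.differentiableAt.differentiableWithinAt
      refine (contDiffOn_one_iff_derivWithin isOpen_Ioo.uniqueDiffOn).2 ⟨hdo, ?_⟩
      refine ContinuousOn.congr (f := deriv (x (y, v))) ?_
        fun _ ↦ derivWithin_of_isOpen isOpen_Ioo
      refine (hF.continuousOn.comp hdo.continuousOn fun t ht ↦ (hv t ht).1).congr fun t ht ↦ ?_
      exact (hv t ht).2.deriv
    have hmem0 : (0 : ℝ) ∈ Ioo (-1 : ℝ) 2 := by norm_num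
    refine ⟨congrArg Prod.fst h0, (hderiv hmem0).trans (congrArg Prod.snd h0), fun t ht ↦ ⟨(hv t ht).1.1, ?_, ?_⟩⟩
    · have : ContDiffOn ℝ (1 + 1) (fun t ↦ (x (y, v) t).1) (Ioo (-1) 2) := by
        refine (contDiffOn_succ_iff_deriv_of_isOpen isOpen_Ioo).2
          ⟨fun t ht ↦ (hc t ht).differentiableAt.differentiableWithinAt, by simp, ?_⟩
        exact (contDiff_snd.comp_contDiffOn hcont).congr hderiv
      exact (this.contDiffAt (isOpen_Ioo.mem_nhds ht)).of_le (by norm_num)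
    · rw [(hderiv.eventuallyEq_of_mem (isOpen_Ioo.mem_nhds ht)).deriv_eq, hderiv ht, (hc' t ht).deriv]

end VectorSpaceGeodesic

/-! ### Riemannian metrics in charts -/

section Charts

variable {E : Type*} [NormedAddCommGroup E] [NormedSpace ℝ E]
  {Q : Type*} [TopologicalSpace Q] [ChartedSpace E Q]

section Differential

variable {e : OpenPartialHomeomorph Q E}

theorem contMDiffAt_chart (he : e ∈ IsManifold.maximalAtlas 𝓘(ℝ, E) ∞ Q) {x : Q}
    (hx : x ∈ e.source) : ContMDiffAt 𝓘(ℝ, E) 𝓘(ℝ, E) ∞ e x :=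
  contMDiffAt_of_mem_maximalAtlas he hx

theorem contMDiffAt_chart_symm (he : e ∈ IsManifold.maximalAtlas 𝓘(ℝ, E) ∞ Q) {y : E}
    (hy : y ∈ e.target) : ContMDiffAt 𝓘(ℝ, E) 𝓘(ℝ, E) ∞ e.symm y :=
  contMDiffAt_symm_of_mem_maximalAtlas he hy

theorem mdifferentiableAt_chart (he : e ∈ IsManifold.maximalAtlas 𝓘(ℝ, E) ∞ Q) {x : Q}
    (hx : x ∈ e.source) : MDifferentiableAt 𝓘(ℝ, E) 𝓘(ℝ, E) e x :=
  (contMDiffAt_chart he hx).mdifferentiableAt (by simp)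

theorem mdifferentiableAt_chart_symm (he : e ∈ IsManifold.maximalAtlas 𝓘(ℝ, E) ∞ Q) {y : E}
    (hy : y ∈ e.target) : MDifferentiableAt 𝓘(ℝ, E) 𝓘(ℝ, E) e.symm y :=
  (contMDiffAt_chart_symm he hy).mdifferentiableAt (by simp)

theorem mfderiv_chart_symm_injective [IsManifold 𝓘(ℝ, E) ∞ Q]
    (he : e ∈ IsManifold.maximalAtlas 𝓘(ℝ, E) ∞ Q) {y : E}
    (hy : y ∈ e.target) : Function.Injective (mfderiv 𝓘(ℝ, E) 𝓘(ℝ, E) e.symm y) := by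
  have h : e.symm.MDifferentiable 𝓘(ℝ, E) 𝓘(ℝ, E) :=
    ⟨fun y hy ↦ (mdifferentiableAt_chart_symm he hy).mdifferentiableWithinAt,
      fun x hx ↦ (mdifferentiableAt_chart he hx).mdifferentiableWithinAt⟩
  exact h.mfderiv_injective hy

theorem contDiffAt_transition {e₁ e₂ : OpenPartialHomeomorph Q E}
    (he₁ : e₁ ∈ IsManifold.maximalAtlas 𝓘(ℝ, E) ∞ Q)
    (he₂ : e₂ ∈ IsManifold.maximalAtlas 𝓘(ℝ, E) ∞ Q) {y : E} (hy : y ∈ e₂.target)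
    (hy₁ : e₂.symm y ∈ e₁.source) : ContDiffAt ℝ ∞ (fun z ↦ e₁ (e₂.symm z)) y :=
  ((contMDiffAt_chart he₁ hy₁).comp y (contMDiffAt_chart_symm he₂ hy)).contDiffAt

theorem contDiffAt_chart_comp (he : e ∈ IsManifold.maximalAtlas 𝓘(ℝ, E) ∞ Q) {γ : ℝ → Q} {t : ℝ}
    {n : WithTop ℕ∞} (hn : n ≤ ∞)
    (hγ : ContMDiffAt 𝓘(ℝ, ℝ) 𝓘(ℝ, E) n γ t) (ht : γ t ∈ e.source) :
    ContDiffAt ℝ n (fun s ↦ e (γ s)) t :=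
  (((contMDiffAt_chart he ht).of_le hn).comp t hγ).contDiffAt

theorem deriv_chart_comp (he : e ∈ IsManifold.maximalAtlas 𝓘(ℝ, E) ∞ Q) {γ : ℝ → Q} {t : ℝ}
    (hγ : MDifferentiableAt 𝓘(ℝ, ℝ) 𝓘(ℝ, E) γ t) (ht : γ t ∈ e.source) :
    deriv (fun s ↦ e (γ s)) t =
      mfderiv 𝓘(ℝ, E) 𝓘(ℝ, E) e (γ t) (mfderiv 𝓘(ℝ, ℝ) 𝓘(ℝ, E) γ t (1 : ℝ)) := by
  have h := mfderiv_comp t (mdifferentiableAt_chart he ht) hγ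
  rw [mfderiv_eq_fderiv] at h
  rw [← fderiv_apply_one_eq_deriv]
  exact DFunLike.congr_fun h (1 : ℝ)

end Differential

variable [RiemannianBundle (fun x : Q ↦ TangentSpace 𝓘(ℝ, E) x)]

variable (E) in
/-- The Riemannian inner product at `x` of two tangent vectors, given as elements of the model
space. -/
noncomputable def tangentInner (x : Q) (u v : E) : ℝ :=
  @inner ℝ (TangentSpace 𝓘(ℝ, E) x) _ u v

theorem chartMetric_eq_tangentInner (e : OpenPartialHomeomorph Q E) (y u v : E) :
    chartMetric e y u v = tangentInner E (e.symm y) (mfderiv 𝓘(ℝ, E) 𝓘(ℝ, E) e.symm y u)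
      (mfderiv 𝓘(ℝ, E) 𝓘(ℝ, E) e.symm y v) := rfl

/-- The points `f₁ y` and `f₂ y` are only propositionally equal, so the two inner products live on
different fibres; reading vectors in `E` allows both point and derivative to be substituted. -/
theorem tangentInner_mfderiv_congr {f₁ f₂ : E → Q} {y : E} (h : f₁ =ᶠ[𝓝 y] f₂) (u v : E) :
    tangentInner E (f₁ y) (mfderiv 𝓘(ℝ, E) 𝓘(ℝ, E) f₁ y u) (mfderiv 𝓘(ℝ, E) 𝓘(ℝ, E) f₁ y v) =
      tangentInner E (f₂ y) (mfderiv 𝓘(ℝ, E) 𝓘(ℝ, E) f₂ y u) (mfderiv 𝓘(ℝ, E) 𝓘(ℝ, E) f₂ y v) := by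
  have hm : (mfderiv 𝓘(ℝ, E) 𝓘(ℝ, E) f₁ y : E →L[ℝ] E) = mfderiv 𝓘(ℝ, E) 𝓘(ℝ, E) f₂ y :=
    h.mfderiv_eq
  have key : ∀ (x₁ x₂ : Q) (D₁ D₂ : E →L[ℝ] E), x₁ = x₂ → D₁ = D₂ →
      tangentInner E x₁ (D₁ u) (D₁ v) = tangentInner E x₂ (D₂ u) (D₂ v) := by
    rintro _ _ _ _ rfl rfl; rfl
  exact key _ _ _ _ h.self_of_nhds hm

theorem chartMetric_comm (e : OpenPartialHomeomorph Q E) (y u v : E) :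
    chartMetric e y u v = chartMetric e y v u :=
  real_inner_comm _ _

theorem chartMetric_add_left (e : OpenPartialHomeomorph Q E) (y u u' v : E) :
    chartMetric e y (u + u') v = chartMetric e y u v + chartMetric e y u' v := by
  have h : (mfderiv 𝓘(ℝ, E) 𝓘(ℝ, E) e.symm y : E →L[ℝ] E) (u + u') = _ := map_add _ u u'
  exact (congrArg (tangentInner E (e.symm y) · _) h).trans
    (inner_add_left (𝕜 := ℝ) (E := TangentSpace 𝓘(ℝ, E) (e.symm y)) _ _ _)

theorem chartMetric_smul_left (e : OpenPartialHomeomorph Q E) (y : E) (c : ℝ) (u v : E) :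
    chartMetric e y (c • u) v = c • chartMetric e y u v := by
  have h : (mfderiv 𝓘(ℝ, E) 𝓘(ℝ, E) e.symm y : E →L[ℝ] E) (c • u) = _ := map_smul _ c u
  exact (congrArg (tangentInner E (e.symm y) · _) h).trans
    (real_inner_smul_left (F := TangentSpace 𝓘(ℝ, E) (e.symm y)) _ _ _)

theorem chartMetric_pos [IsManifold 𝓘(ℝ, E) ∞ Q] {e : OpenPartialHomeomorph Q E}
    (he : e ∈ IsManifold.maximalAtlas 𝓘(ℝ, E) ∞ Q) {y : E}
    (hy : y ∈ e.target) {u : E} (hu : u ≠ 0) : 0 < chartMetric e y u u := by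
  refine real_inner_self_pos.2 fun h ↦ hu ?_
  exact mfderiv_chart_symm_injective he hy (h.trans (map_zero _).symm)

/-- The transformation of the coordinates of the metric under a change of charts. -/
theorem chartMetric_transition {e₁ e₂ : OpenPartialHomeomorph Q E}
    (he₁ : e₁ ∈ IsManifold.maximalAtlas 𝓘(ℝ, E) ∞ Q)
    (he₂ : e₂ ∈ IsManifold.maximalAtlas 𝓘(ℝ, E) ∞ Q) {y : E} (hy : y ∈ e₂.target)
    (hy₁ : e₂.symm y ∈ e₁.source) (u v : E) :
    chartMetric e₂ y u v = chartMetric e₁ (e₁ (e₂.symm y))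
      (fderiv ℝ (fun z ↦ e₁ (e₂.symm z)) y u) (fderiv ℝ (fun z ↦ e₁ (e₂.symm z)) y v) := by
  have hloc : e₂.symm =ᶠ[𝓝 y] fun z ↦ e₁.symm (e₁ (e₂.symm z)) := by
    have := (e₂.continuousAt_symm hy).eventually (e₁.open_source.mem_nhds hy₁)
    filter_upwards [this] with z hz
    exact (e₁.left_inv hz).symm
  have hψ : MDifferentiableAt 𝓘(ℝ, E) 𝓘(ℝ, E) (fun z ↦ e₁ (e₂.symm z)) y :=
    ((contDiffAt_transition he₁ he₂ hy hy₁).differentiableAt (by simp)).mdifferentiableAt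
  have hcomp := mfderiv_comp y (g := e₁.symm) (f := fun z ↦ e₁ (e₂.symm z))
    (mdifferentiableAt_chart_symm he₁ (e₁.map_source hy₁)) hψ
  rw [mfderiv_eq_fderiv] at hcomp
  rw [chartMetric_eq_tangentInner, tangentInner_mfderiv_congr hloc, chartMetric_eq_tangentInner]
  have h : ∀ w : E, (mfderiv 𝓘(ℝ, E) 𝓘(ℝ, E) (fun z ↦ e₁.symm (e₁ (e₂.symm z))) y w : E) =
      mfderiv 𝓘(ℝ, E) 𝓘(ℝ, E) e₁.symm (e₁ (e₂.symm y)) (fderiv ℝ (fun z ↦ e₁ (e₂.symm z)) y w) :=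
    fun w ↦ DFunLike.congr_fun hcomp w
  exact congrArg₂ (tangentInner E _) (h u) (h v)

/-- The coordinate expression of the Riemannian metric as a field of bilinear forms. -/
noncomputable def chartForm [FiniteDimensional ℝ E] (e : OpenPartialHomeomorph Q E) (y : E) : E →L[ℝ] E →L[ℝ] ℝ :=
  LinearMap.toContinuousLinearMap
    ((LinearMap.toContinuousLinearMap : (E →ₗ[ℝ] ℝ) ≃ₗ[ℝ] E →L[ℝ] ℝ).toLinearMap ∘ₗ
      LinearMap.mk₂ ℝ (chartMetric e y)
        (chartMetric_add_left e y) (chartMetric_smul_left e y)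
        (fun u v v' ↦ by simp only [chartMetric_comm e y u, chartMetric_add_left])
        (fun c u v ↦ by simp only [chartMetric_comm e y u, chartMetric_smul_left]))

@[simp]
theorem chartForm_apply [FiniteDimensional ℝ E] (e : OpenPartialHomeomorph Q E) (y u v : E) :
    chartForm e y u v = chartMetric e y u v := rfl

variable [IsManifold 𝓘(ℝ, E) ∞ Q]
  [IsContMDiffRiemannianBundle 𝓘(ℝ, E) ∞ E (fun x : Q ↦ TangentSpace 𝓘(ℝ, E) x)]
  {e : OpenPartialHomeomorph Q E}

/-- The coordinate field of a fixed `w` is the tangent map of `e.symm` along a constant section,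
hence smooth, and the metric is smooth on smooth sections. -/
theorem contDiffOn_chartMetric (he : e ∈ IsManifold.maximalAtlas 𝓘(ℝ, E) ∞ Q) (u v : E) :
    ContDiffOn ℝ ∞ (fun y ↦ chartMetric e y u v) e.target := by
  have h : ∀ w : E, ContMDiffOn 𝓘(ℝ, E) 𝓘(ℝ, E).tangent ∞
      (fun y ↦ (⟨e.symm y, mfderiv 𝓘(ℝ, E) 𝓘(ℝ, E) e.symm y w⟩ : TangentBundle 𝓘(ℝ, E) Q))
      e.target := by
    intro w
    have h1 := (contMDiffOn_symm_of_mem_maximalAtlas he).contMDiffOn_tangentMapWithin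
      (m := ∞) (by simp) e.open_target.uniqueMDiffOn
    have h2 : ContMDiffOn 𝓘(ℝ, E) 𝓘(ℝ, E).tangent ∞
        (fun y ↦ (⟨y, w⟩ : TangentBundle 𝓘(ℝ, E) E)) e.target :=
      contMDiffOn_vectorSpace_iff_contDiffOn.2 contDiffOn_const
    refine (h1.comp h2 fun y hy ↦ hy).congr fun y hy ↦ ?_
    simp only [Function.comp_apply, tangentMapWithin, mfderivWithin_of_isOpen e.open_target hy]
  exact contMDiffOn_iff_contDiffOn.1 (ContMDiffOn.inner_bundle (h u) (h v))

variable [FiniteDimensional ℝ E]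

theorem contDiffOn_chartForm (he : e ∈ IsManifold.maximalAtlas 𝓘(ℝ, E) ∞ Q) :
    ContDiffOn ℝ ∞ (chartForm e) e.target :=
  contDiffOn_clm_apply.2 fun u ↦ contDiffOn_clm_apply.2 fun v ↦ contDiffOn_chartMetric he u v

theorem chartChristoffel_self (he : e ∈ IsManifold.maximalAtlas 𝓘(ℝ, E) ∞ Q) {y : E}
    (hy : y ∈ e.target) (v w : E) :
    chartChristoffel e y v v w = christoffelForm (chartForm e) y v w := by
  have hd : DifferentiableAt ℝ (chartForm e) y :=
    ((contDiffOn_chartForm he).contDiffAt (e.open_target.mem_nhds hy)).differentiableAt (by simp)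
  have h : ∀ a b c : E, fderiv ℝ (fun z ↦ chartMetric e z a b) y c =
      fderiv ℝ (chartForm e) y c a b := by
    intro a b c
    have h1 : HasFDerivAt (fun z ↦ chartForm e z a b) _ y :=
      (hd.hasFDerivAt.clm_apply (hasFDerivAt_const a _)).clm_apply (hasFDerivAt_const b _)
    have h2 : HasFDerivAt (fun z ↦ chartMetric e z a b) _ y := h1
    rw [h2.fderiv]
    simp
  rw [chartChristoffel, h, h, christoffelForm_apply]
  ring

/-- The geodesic equation at a point in a chart, solved for the second derivative. -/
theorem chart_geodesic_equation_iff (he : e ∈ IsManifold.maximalAtlas 𝓘(ℝ, E) ∞ Q) {y : E}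
    (hy : y ∈ e.target) (v a : E) :
    (∀ w, chartMetric e y a w + chartChristoffel e y v v w = 0) ↔
      a = geodesicAccel (chartForm e) (y, v) := by
  simp only [chartChristoffel_self he hy]
  exact geodesicAccel_eq_iff (g := chartForm e) fun u hu ↦ chartMetric_pos he hy hu

/-- The geodesic equation does not depend on the chart. -/
theorem chart_geodesic_equation_independent {e₁ e₂ : OpenPartialHomeomorph Q E}
    (he₁ : e₁ ∈ IsManifold.maximalAtlas 𝓘(ℝ, E) ∞ Q)
    (he₂ : e₂ ∈ IsManifold.maximalAtlas 𝓘(ℝ, E) ∞ Q) {γ : ℝ → Q} {t : ℝ}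
    (hγ : ContMDiffAt 𝓘(ℝ, ℝ) 𝓘(ℝ, E) 2 γ t) (h₁ : γ t ∈ e₁.source) (h₂ : γ t ∈ e₂.source)
    (heq : ∀ w : E, chartMetric e₁ (e₁ (γ t)) (deriv (deriv (fun s ↦ e₁ (γ s))) t) w
        + chartChristoffel e₁ (e₁ (γ t)) (deriv (fun s ↦ e₁ (γ s)) t)
            (deriv (fun s ↦ e₁ (γ s)) t) w = 0) (w : E) :
    chartMetric e₂ (e₂ (γ t)) (deriv (deriv (fun s ↦ e₂ (γ s))) t) w
        + chartChristoffel e₂ (e₂ (γ t)) (deriv (fun s ↦ e₂ (γ s)) t)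
            (deriv (fun s ↦ e₂ (γ s)) t) w = 0 := by
  have hy : e₂ (γ t) ∈ e₂.target := e₂.map_source h₂
  have hsymm : e₂.symm (e₂ (γ t)) = γ t := e₂.left_inv h₂
  have hy₁ : e₂.symm (e₂ (γ t)) ∈ e₁.source := by rwa [hsymm]
  have hψ := contDiffAt_transition he₁ he₂ hy hy₁
  have hdiff : ∀ {e : OpenPartialHomeomorph Q E}, e ∈ IsManifold.maximalAtlas 𝓘(ℝ, E) ∞ Q →
      ∀ {y : E}, y ∈ e.target → DifferentiableAt ℝ (chartForm e) y := fun he y hy ↦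
    ((contDiffOn_chartForm he).contDiffAt
      ((OpenPartialHomeomorph.open_target _).mem_nhds hy)).differentiableAt (by simp)
  have hg : ∀ᶠ z in 𝓝 (e₂ (γ t)), ∀ u w, chartForm e₂ z u w =
      chartForm e₁ (e₁ (e₂.symm z)) (fderiv ℝ (fun z ↦ e₁ (e₂.symm z)) z u)
        (fderiv ℝ (fun z ↦ e₁ (e₂.symm z)) z w) := by
    filter_upwards [e₂.open_target.mem_nhds hy,
      (e₂.continuousAt_symm hy).eventually (e₁.open_source.mem_nhds hy₁)] with z hz hz₁ u w
    exact chartMetric_transition he₁ he₂ hz hz₁ u w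
  have hkey := geodesic_equation_change_of_coordinates (c := fun s ↦ e₂ (γ s)) (t := t)
    (ψ := fun z ↦ e₁ (e₂.symm z)) (g₁ := chartForm e₁) (g₂ := chartForm e₂)
    (hψ.of_le ENat.LEInfty.out) (contDiffAt_chart_comp he₂ ENat.LEInfty.out hγ h₂)
    (hdiff he₁ (e₁.map_source hy₁)) (hdiff he₂ hy)
    (fun u w ↦ chartMetric_comm e₁ (e₁ (e₂.symm (e₂ (γ t)))) u w) hg w
  have hcc : (fun s ↦ e₁ (e₂.symm (e₂ (γ s)))) =ᶠ[𝓝 t] fun s ↦ e₁ (γ s) := by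
    filter_upwards [hγ.continuousAt.eventually (e₂.open_source.mem_nhds h₂)] with s hs
    rw [e₂.left_inv hs]
  rw [hcc.deriv_eq, hcc.deriv.deriv_eq, hsymm] at hkey
  simp only [chartForm_apply] at hkey
  rw [chartChristoffel_self he₂ hy, hkey, ← chartChristoffel_self he₁ (e₁.map_source h₁)]
  exact heq _

end Charts

/-! ### Uniqueness of geodesics and the Riemannian exponential map -/

section GeodesicUniqueness

variable {E : Type*} [NormedAddCommGroup E] [NormedSpace ℝ E]
  {Q : Type*} [TopologicalSpace Q] [ChartedSpace E Q]
  [RiemannianBundle (fun x : Q ↦ TangentSpace 𝓘(ℝ, E) x)]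
  {γ γ₁ γ₂ : ℝ → Q} {J : Set ℝ} {t : ℝ} {e : OpenPartialHomeomorph Q E}
  {q : Q} {v : TangentSpace 𝓘(ℝ, E) q}

theorem IsGeodesicOn.mono {J' : Set ℝ} (h : IsGeodesicOn (E := E) γ J) (hJ : J' ⊆ J) :
    IsGeodesicOn (E := E) γ J' :=
  ⟨h.1.mono hJ, fun e he t ht ↦ h.2 e he t (hJ ht)⟩

theorem IsUnitTimeGeodesic.mdifferentiableAt (h : IsUnitTimeGeodesic q v γ) :
    MDifferentiableAt 𝓘(ℝ, ℝ) 𝓘(ℝ, E) γ 0 := by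
  obtain ⟨⟨J, hJ, -, hIJ, hγ⟩, -⟩ := h
  exact (hγ.1.contMDiffAt (hJ.mem_nhds (hIJ (by simp)))).mdifferentiableAt (by simp)

theorem IsUnitTimeGeodesic.apply_zero (h : IsUnitTimeGeodesic q v γ) : γ 0 = q :=
  congrArg TotalSpace.proj h.2

theorem IsUnitTimeGeodesic.deriv_chart (h : IsUnitTimeGeodesic q v γ)
    (he : e ∈ IsManifold.maximalAtlas 𝓘(ℝ, E) ∞ Q) (hq : q ∈ e.source) :
    deriv (fun s ↦ e (γ s)) 0 = mfderiv 𝓘(ℝ, E) 𝓘(ℝ, E) e q v := by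
  rw [deriv_chart_comp he h.mdifferentiableAt (h.apply_zero.symm ▸ hq)]
  exact congrArg (fun p : TangentBundle 𝓘(ℝ, E) Q ↦ (mfderiv 𝓘(ℝ, E) 𝓘(ℝ, E) e p.1 p.2 : E)) h.2

variable [FiniteDimensional ℝ E] [IsManifold 𝓘(ℝ, E) ∞ Q]
  [IsContMDiffRiemannianBundle 𝓘(ℝ, E) ∞ E (fun x : Q ↦ TangentSpace 𝓘(ℝ, E) x)]

theorem IsGeodesicOn.eventually_deriv_deriv_eq (h : IsGeodesicOn (E := E) γ J) (hJ : IsOpen J)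
    (ht : t ∈ J) (he : e ∈ IsManifold.maximalAtlas 𝓘(ℝ, E) ∞ Q) (hte : γ t ∈ e.source) :
    ∀ᶠ τ in 𝓝 t, deriv (deriv fun s ↦ e (γ s)) τ =
      geodesicAccel (chartForm e) (e (γ τ), deriv (fun s ↦ e (γ s)) τ) := by
  have hc : ContinuousAt γ t := h.1.continuousOn.continuousAt (hJ.mem_nhds ht)
  filter_upwards [hJ.mem_nhds ht, hc.eventually (e.open_source.mem_nhds hte)] with τ hτ hτe
  exact (chart_geodesic_equation_iff he (e.map_source hτe) _ _).1 (h.2 e he τ hτ hτe)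

/-- Two geodesics with the same position and velocity at `t` agree near `t`. -/
theorem IsGeodesicOn.eventuallyEq (h₁ : IsGeodesicOn (E := E) γ₁ J)
    (h₂ : IsGeodesicOn (E := E) γ₂ J) (hJ : IsOpen J) (ht : t ∈ J)
    (he : e ∈ IsManifold.maximalAtlas 𝓘(ℝ, E) ∞ Q) (hte : γ₁ t ∈ e.source) (heq : γ₁ t = γ₂ t)
    (hderiv : deriv (fun s ↦ e (γ₁ s)) t = deriv (fun s ↦ e (γ₂ s)) t) : γ₁ =ᶠ[𝓝 t] γ₂ := by
  have hc₁ := h₁.1.contMDiffAt (hJ.mem_nhds ht)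
  have hc₂ := h₂.1.contMDiffAt (hJ.mem_nhds ht)
  have hte₂ : γ₂ t ∈ e.source := heq ▸ hte
  have key := geodesic_equation_eventuallyEq e.open_target (contDiffOn_chartForm he)
    (fun y hy u hu ↦ chartMetric_pos he hy hu) (contDiffAt_chart_comp he ENat.LEInfty.out hc₁ hte)
    (contDiffAt_chart_comp he ENat.LEInfty.out hc₂ hte₂)
    (h₁.eventually_deriv_deriv_eq hJ ht he hte) (h₂.eventually_deriv_deriv_eq hJ ht he hte₂)
    (e.map_source hte) (congrArg e heq) hderiv
  filter_upwards [key, hc₁.continuousAt.eventually (e.open_source.mem_nhds hte),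
    hc₂.continuousAt.eventually (e.open_source.mem_nhds hte₂)] with s hs hs₁ hs₂
  exact e.injOn hs₁ hs₂ hs

/-- Two geodesics on an open interval that agree near one time agree everywhere. -/
theorem IsGeodesicOn.eqOn [T2Space Q] (h₁ : IsGeodesicOn (E := E) γ₁ J)
    (h₂ : IsGeodesicOn (E := E) γ₂ J) (hJ : IsOpen J) (hJc : IsPreconnected J) (ht : t ∈ J)
    (heq : γ₁ =ᶠ[𝓝 t] γ₂) : EqOn γ₁ γ₂ J := by
  let S : Set ℝ := {τ | γ₁ =ᶠ[𝓝 τ] γ₂}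
  suffices hsub : J ⊆ S from fun τ hτ ↦ (hsub hτ).self_of_nhds
  -- The set of times of local agreement is open. At a limit time the positions agree since `Q` is
  -- Hausdorff and the chart velocities agree by continuity, so local uniqueness puts that time in
  -- the set as well.
  refine hJc.subset_of_closure_inter_subset isOpen_setOfPred_eventually_nhds ⟨t, ht, heq⟩ ?_
  rintro τ ⟨hτS, hτ⟩
  have hne : (𝓝[S] τ).NeBot := mem_closure_iff_nhdsWithin_neBot.1 hτS
  have hc₁ := h₁.1.contMDiffAt (hJ.mem_nhds hτ)
  have hc₂ := h₂.1.contMDiffAt (hJ.mem_nhds hτ)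
  have hτeq : γ₁ τ = γ₂ τ :=
    tendsto_nhds_unique_of_eventuallyEq (hc₁.continuousAt.mono_left nhdsWithin_le_nhds)
      (hc₂.continuousAt.mono_left nhdsWithin_le_nhds)
      ((eventually_mem_nhdsWithin (s := S)).mono fun σ hσ ↦ Filter.EventuallyEq.eq_of_nhds hσ)
  let e := chartAt E (γ₁ τ)
  have he : e ∈ IsManifold.maximalAtlas 𝓘(ℝ, E) ∞ Q := IsManifold.chart_mem_maximalAtlas _
  have hsrc : γ₁ τ ∈ e.source := mem_chart_source E (γ₁ τ)
  have hcd : ∀ {γ : ℝ → Q}, ContMDiffAt 𝓘(ℝ, ℝ) 𝓘(ℝ, E) 2 γ τ → γ τ ∈ e.source →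
      ContinuousAt (deriv fun s ↦ e (γ s)) τ := fun h hs ↦ by
    have := ((contDiffAt_chart_comp he ENat.LEInfty.out h hs).fderiv_right
      (m := 1) (by norm_num)).continuousAt.clm_apply (continuousAt_const (y := (1 : ℝ)))
    simpa only [fderiv_apply_one_eq_deriv] using this
  refine h₁.eventuallyEq h₂ hJ hτ he hsrc hτeq ?_
  refine tendsto_nhds_unique_of_eventuallyEq ((hcd hc₁ hsrc).mono_left nhdsWithin_le_nhds)
    ((hcd hc₂ (hτeq ▸ hsrc)).mono_left nhdsWithin_le_nhds)
    ((eventually_mem_nhdsWithin (s := S)).mono fun σ hσ ↦ ?_)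
  exact Filter.EventuallyEq.deriv_eq (Filter.EventuallyEq.fun_comp hσ e)

/-- The two intervals of definition meet in an open interval containing `0` and `1`, and the initial
data agree in the chart at `q`. The value of `riemannianExp` is thereby independent of the choice in
its definition. -/
theorem IsUnitTimeGeodesic.apply_one_unique [T2Space Q] (h₁ : IsUnitTimeGeodesic q v γ₁)
    (h₂ : IsUnitTimeGeodesic q v γ₂) : γ₁ 1 = γ₂ 1 := by
  obtain ⟨J₁, hJ₁, hc₁, hI₁, hγ₁⟩ := h₁.1
  obtain ⟨J₂, hJ₂, hc₂, hI₂, hγ₂⟩ := h₂.1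
  have hg₁ := hγ₁.mono (inter_subset_left (t := J₂))
  have hg₂ := hγ₂.mono (inter_subset_right (s := J₁))
  have h0 : (0 : ℝ) ∈ J₁ ∩ J₂ := ⟨hI₁ (by simp), hI₂ (by simp)⟩
  have hsrc := mem_chart_source E q
  have he : chartAt E q ∈ IsManifold.maximalAtlas 𝓘(ℝ, E) ∞ Q :=
    IsManifold.chart_mem_maximalAtlas q
  refine hg₁.eqOn hg₂ (hJ₁.inter hJ₂) (hc₁.inter hc₂).isPreconnected h0
    (hg₁.eventuallyEq hg₂ (hJ₁.inter hJ₂) h0 he (h₁.apply_zero.symm ▸ hsrc)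
      (h₁.apply_zero.trans h₂.apply_zero.symm) ?_) ⟨hI₁ (by simp), hI₂ (by simp)⟩
  rw [h₁.deriv_chart he hsrc, h₂.deriv_chart he hsrc]

theorem IsUnitTimeGeodesic.riemannianExp_eq [T2Space Q] (h : IsUnitTimeGeodesic q v γ) :
    riemannianExp q v = γ 1 := by
  have hex : ∃ γ : ℝ → Q, IsUnitTimeGeodesic q v γ := ⟨γ, h⟩
  rw [riemannianExp, dif_pos hex]
  exact hex.choose_spec.apply_one_unique h

end GeodesicUniqueness

/-! ### Isometric actions -/

section Isometries

variable {E : Type*} [NormedAddCommGroup E] [NormedSpace ℝ E]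
  {Q : Type*} [TopologicalSpace Q] [ChartedSpace E Q]
  {G : Type*} [Group G] [MulAction G Q]

/-- The diffeomorphism of `Q` given by an element of a group acting by smooth maps. -/
def smulDiffeomorph (hs : ∀ g : G, ContMDiff 𝓘(ℝ, E) 𝓘(ℝ, E) ∞ fun x : Q ↦ g • x) (g : G) :
    Q ≃ₘ^∞⟮𝓘(ℝ, E), 𝓘(ℝ, E)⟯ Q where
  toEquiv := MulAction.toPerm g
  contMDiff_toFun := hs g
  contMDiff_invFun := hs g⁻¹

/-- The chart obtained from `e` by composing with the action of `g`. -/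
noncomputable def chartTranslate (hs : ∀ g : G, ContMDiff 𝓘(ℝ, E) 𝓘(ℝ, E) ∞ fun x : Q ↦ g • x)
    (g : G) (e : OpenPartialHomeomorph Q E) : OpenPartialHomeomorph Q E :=
  (smulDiffeomorph hs g).toHomeomorph.toOpenPartialHomeomorph.trans e

variable (hs : ∀ g : G, ContMDiff 𝓘(ℝ, E) 𝓘(ℝ, E) ∞ fun x : Q ↦ g • x)
  {e : OpenPartialHomeomorph Q E}

theorem chartTranslate_mem_maximalAtlas [IsManifold 𝓘(ℝ, E) ∞ Q] (g : G)
    (he : e ∈ IsManifold.maximalAtlas 𝓘(ℝ, E) ∞ Q) :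
    chartTranslate hs g e ∈ IsManifold.maximalAtlas 𝓘(ℝ, E) ∞ Q := by
  refine OpenPartialHomeomorph.mem_maximalAtlas_of_contMDiffOn _ ?_ ?_
  · exact (contMDiffOn_of_mem_maximalAtlas he).comp (hs g).contMDiffOn fun x hx ↦ hx.2
  · exact (hs g⁻¹).comp_contMDiffOn
      ((contMDiffOn_symm_of_mem_maximalAtlas he).mono fun y hy ↦ hy.1)

variable [RiemannianBundle (fun x : Q ↦ TangentSpace 𝓘(ℝ, E) x)]

theorem ActsByIsometries.tangentInner_mfderiv (hG : ActsByIsometries E Q G) (g : G) (x : Q)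
    (u v : E) :
    tangentInner E (g • x) (mfderiv 𝓘(ℝ, E) 𝓘(ℝ, E) (fun y : Q ↦ g • y) x u)
      (mfderiv 𝓘(ℝ, E) 𝓘(ℝ, E) (fun y : Q ↦ g • y) x v) = tangentInner E x u v :=
  hG g x u v

theorem ActsByIsometries.inner_isotropyRep (hG : ActsByIsometries E Q G) {q : Q}
    (h : MulAction.stabilizer G q) (u v : TangentSpace 𝓘(ℝ, E) q) :
    inner ℝ (isotropyRep E q h u) (isotropyRep E q h v) = inner ℝ u v := by
  have key : ∀ (p : Q), p = q → ∀ a b : E, tangentInner E p a b = tangentInner E q a b := by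
    rintro p rfl a b; rfl
  exact (key _ h.2 _ _).symm.trans (hG.tangentInner_mfderiv (h : G) q u v)

/-- This makes balls around `0` in `T_q Q` invariant under the stabilizer. -/
theorem ActsByIsometries.norm_isotropyRep (hG : ActsByIsometries E Q G) {q : Q}
    (h : MulAction.stabilizer G q) (v : TangentSpace 𝓘(ℝ, E) q) :
    ‖isotropyRep E q h v‖ = ‖v‖ := by
  rw [@norm_eq_sqrt_real_inner (TangentSpace 𝓘(ℝ, E) q), hG.inner_isotropyRep,
    ← norm_eq_sqrt_real_inner]

/-- An isometry does not change the coordinates of the metric, if the chart moves along. -/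
theorem ActsByIsometries.chartMetric_chartTranslate (hG : ActsByIsometries E Q G) (g : G)
    (he : e ∈ IsManifold.maximalAtlas 𝓘(ℝ, E) ∞ Q) {y : E} (hy : y ∈ e.target) (u v : E) :
    chartMetric (chartTranslate hs g e) y u v = chartMetric e y u v := by
  -- The inverse of the translated chart is `g⁻¹ • e.symm`, so the isometry that enters is `g⁻¹`.
  have hd : MDifferentiableAt 𝓘(ℝ, E) 𝓘(ℝ, E) (fun x : Q ↦ g⁻¹ • x) (e.symm y) :=
    (hs g⁻¹).mdifferentiableAt (by simp)
  have hcomp := mfderiv_comp y hd (mdifferentiableAt_chart_symm he hy)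
  exact (congrArg₂ (tangentInner E (g⁻¹ • e.symm y)) (DFunLike.congr_fun hcomp u)
    (DFunLike.congr_fun hcomp v)).trans (hG.tangentInner_mfderiv g⁻¹ (e.symm y) _ _)

theorem ActsByIsometries.chartChristoffel_chartTranslate (hG : ActsByIsometries E Q G) (g : G)
    (he : e ∈ IsManifold.maximalAtlas 𝓘(ℝ, E) ∞ Q) {y : E} (hy : y ∈ e.target) (u v w : E) :
    chartChristoffel (chartTranslate hs g e) y u v w = chartChristoffel e y u v w := by
  have h : ∀ a b : E, (fun z ↦ chartMetric (chartTranslate hs g e) z a b) =ᶠ[𝓝 y]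
      fun z ↦ chartMetric e z a b := fun a b ↦ by
    filter_upwards [e.open_target.mem_nhds hy] with z hz
    exact hG.chartMetric_chartTranslate hs g he hz a b
  simp only [chartChristoffel, (h _ _).fderiv_eq]

variable [IsManifold 𝓘(ℝ, E) ∞ Q]

/-- Isometries map geodesics to geodesics. -/
theorem IsGeodesicOn.smul
    (hs : ∀ g : G, ContMDiff 𝓘(ℝ, E) 𝓘(ℝ, E) ∞ fun x : Q ↦ g • x)
    (hG : ActsByIsometries E Q G) (g : G) {γ : ℝ → Q} {J : Set ℝ}
    (h : IsGeodesicOn (E := E) γ J) : IsGeodesicOn (E := E) (fun t ↦ g • γ t) J := by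
  refine ⟨((hs g).of_le ENat.LEInfty.out).comp_contMDiffOn h.1, fun e he t ht hte w ↦ ?_⟩
  -- The coordinate expression of `g • γ` in `e` is that of `γ` in the translated chart, where the
  -- metric has the same coefficients; the two geodesic equations therefore coincide.
  have key := h.2 (chartTranslate hs g e) (chartTranslate_mem_maximalAtlas hs g he) t ht
    ⟨mem_univ _, hte⟩ w
  have happ : ∀ s, chartTranslate hs g e (γ s) = e (g • γ s) := fun _ ↦ rfl
  simp only [happ] at key
  rwa [hG.chartMetric_chartTranslate hs g he (e.map_source hte),
    hG.chartChristoffel_chartTranslate hs g he (e.map_source hte)] at key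

variable {q : Q} {v : TangentSpace 𝓘(ℝ, E) q}

theorem IsUnitTimeGeodesic.smul
    (hs : ∀ g : G, ContMDiff 𝓘(ℝ, E) 𝓘(ℝ, E) ∞ fun x : Q ↦ g • x)
    (hG : ActsByIsometries E Q G) (h : MulAction.stabilizer G q)
    {γ : ℝ → Q} (hγ : IsUnitTimeGeodesic q v γ) :
    IsUnitTimeGeodesic q (isotropyRep E q h v) (fun t ↦ (h : G) • γ t) := by
  refine ⟨?_, ?_⟩
  · obtain ⟨J, hJ, hJc, hIJ, hg⟩ := hγ.1
    exact ⟨J, hJ, hJc, hIJ, hg.smul hs hG h⟩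
  · rw [isotropyRep_eq_tangentMap, ← hγ.2]
    have hd : MDifferentiableAt 𝓘(ℝ, E) 𝓘(ℝ, E) (fun x : Q ↦ (h : G) • x) (γ 0) :=
      (hs h).mdifferentiableAt (by simp)
    have hcomp := mfderiv_comp 0 hd hγ.mdifferentiableAt
    exact congrArg (fun a : E ↦ (⟨(h : G) • γ 0, a⟩ : TangentBundle 𝓘(ℝ, E) Q))
      (DFunLike.congr_fun hcomp (1 : ℝ))

/-- The exponential map intertwines the isotropy representation with the action. -/
theorem ActsByIsometries.riemannianExp_isotropyRep [FiniteDimensional ℝ E] [T2Space Q]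
    [IsContMDiffRiemannianBundle 𝓘(ℝ, E) ∞ E (fun x : Q ↦ TangentSpace 𝓘(ℝ, E) x)]
    (hs : ∀ g : G, ContMDiff 𝓘(ℝ, E) 𝓘(ℝ, E) ∞ fun x : Q ↦ g • x)
    (hG : ActsByIsometries E Q G) (h : MulAction.stabilizer G q) (hv : v ∈ expDomain q) :
    riemannianExp q (isotropyRep E q h v) = (h : G) • riemannianExp q v := by
  obtain ⟨γ, hγ⟩ := hv
  rw [hγ.riemannianExp_eq, (hγ.smul hs hG h).riemannianExp_eq]

end Isometries

/-! ### Local structure of the exponential map -/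

section LocalExp

variable {E : Type*} [NormedAddCommGroup E] [NormedSpace ℝ E]
  {Q : Type*} [TopologicalSpace Q] [ChartedSpace E Q] [IsManifold 𝓘(ℝ, E) ∞ Q]

/-- The tangent space at `q` is modelled on `E` through the preferred chart at `q`, so a tangent
vector at `q` is its own coordinate vector there. -/
theorem mfderiv_chartAt_self (q : Q) (v : TangentSpace 𝓘(ℝ, E) q) :
    (mfderiv 𝓘(ℝ, E) 𝓘(ℝ, E) (chartAt E q) q v : E) = v :=
  DFunLike.congr_fun (mfderiv_extChartAt_self (I := 𝓘(ℝ, E)) (x := q)) v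

variable [FiniteDimensional ℝ E] [RiemannianBundle (fun x : Q ↦ TangentSpace 𝓘(ℝ, E) x)]
  [IsContMDiffRiemannianBundle 𝓘(ℝ, E) ∞ E (fun x : Q ↦ TangentSpace 𝓘(ℝ, E) x)]

variable (E) in
theorem isUnitTimeGeodesic_const (q : Q) :
    IsUnitTimeGeodesic q (0 : TangentSpace 𝓘(ℝ, E) q) (fun _ ↦ q) := by
  refine ⟨⟨univ, isOpen_univ, ordConnected_univ, subset_univ _, contMDiffOn_const,
    fun e he t _ ht ↦ ?_⟩, ?_⟩
  · simp only [deriv_const']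
    exact (chart_geodesic_equation_iff he (e.map_source ht) _ _).2 (geodesicAccel_zero _ _).symm
  · rw [mfderiv_const]
    rfl

variable (E) in
theorem riemannianExp_zero [T2Space Q] (q : Q) :
    riemannianExp q (0 : TangentSpace 𝓘(ℝ, E) q) = q :=
  (isUnitTimeGeodesic_const E q).riemannianExp_eq

/-- A solution of the geodesic equation in the preferred chart at `q` gives a geodesic. -/
theorem isUnitTimeGeodesic_chartAt_symm {q : Q} {v : TangentSpace 𝓘(ℝ, E) q} {c : ℝ → E}
    (h0 : c 0 = chartAt E q q) (hd : deriv c 0 = v)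
    (hc : ∀ t ∈ Ioo (-1 : ℝ) 2, c t ∈ (chartAt E q).target ∧ ContDiffAt ℝ 2 c t ∧
      deriv (deriv c) t = geodesicAccel (chartForm (chartAt E q)) (c t, deriv c t)) :
    IsUnitTimeGeodesic q v fun t ↦ (chartAt E q).symm (c t) := by
  set e := chartAt E q with he_def
  have he : e ∈ IsManifold.maximalAtlas 𝓘(ℝ, E) ∞ Q := IsManifold.chart_mem_maximalAtlas q
  have hγ : ∀ t ∈ Ioo (-1 : ℝ) 2,
      ContMDiffAt 𝓘(ℝ, ℝ) 𝓘(ℝ, E) 2 (fun t ↦ e.symm (c t)) t := fun t ht ↦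
    ((contMDiffAt_chart_symm he (hc t ht).1).of_le ENat.LEInfty.out).comp t
      (hc t ht).2.1.contMDiffAt
  have hec : ∀ t ∈ Ioo (-1 : ℝ) 2, (fun s ↦ e (e.symm (c s))) =ᶠ[𝓝 t] c := fun t ht ↦ by
    filter_upwards [isOpen_Ioo.mem_nhds ht] with s hs
    exact e.right_inv (hc s hs).1
  have hmem : (0 : ℝ) ∈ Ioo (-1 : ℝ) 2 := by norm_num
  refine ⟨⟨Ioo (-1) 2, isOpen_Ioo, ordConnected_Ioo, Icc_subset_Ioo (by norm_num) (by norm_num),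
    fun t ht ↦ (hγ t ht).contMDiffWithinAt, fun e' he' t ht hte' w ↦ ?_⟩, ?_⟩
  -- The equation is known only in the preferred chart at `q`; independence of the chart carries it
  -- to every other chart around the same point.
  · refine chart_geodesic_equation_independent he he' (hγ t ht)
      (e.map_target (hc t ht).1) hte' (fun w ↦ ?_) w
    rw [(hec t ht).deriv_eq, (hec t ht).deriv.deriv_eq,
      show e (e.symm (c t)) = c t from e.right_inv (hc t ht).1]
    exact (chart_geodesic_equation_iff he (hc t ht).1 _ _).2 (hc t ht).2.2 w
  · have hq : e.symm (c 0) = q := by rw [h0]; exact e.left_inv (mem_chart_source E q)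
    have hv := deriv_chart_comp he ((hγ 0 hmem).mdifferentiableAt (by simp))
      (e.map_target (hc 0 hmem).1)
    rw [(hec 0 hmem).deriv_eq, hd] at hv
    have key : ∀ (p : Q) (w : E), p = q → (v : E) = mfderiv 𝓘(ℝ, E) 𝓘(ℝ, E) e p w →
        (⟨p, w⟩ : TangentBundle 𝓘(ℝ, E) Q) = ⟨q, v⟩ := by
      rintro p w rfl h
      rw [he_def] at h
      have h' : (v : E) = w := h.trans (mfderiv_chartAt_self p w)
      rw [h']
    exact key _ _ hq hv

/-- The exponential map is defined and smooth near `0`, and its derivative at `0`, in the preferred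
chart, is the identity. -/
theorem exists_riemannianExp_eq [T2Space Q] (q : Q) :
    ∃ (O : Set E) (f : E → E), IsOpen O ∧ (0 : E) ∈ O ∧ ContDiffOn ℝ ∞ f O ∧
      HasFDerivAt f (ContinuousLinearMap.id ℝ E) 0 ∧ ∀ v ∈ O, f v ∈ (chartAt E q).target ∧
        v ∈ expDomain (E := E) q ∧ riemannianExp (E := E) q v = (chartAt E q).symm (f v) := by
  have he : chartAt E q ∈ IsManifold.maximalAtlas 𝓘(ℝ, E) ∞ Q :=
    IsManifold.chart_mem_maximalAtlas q
  obtain ⟨O, c, hO, h0, hc, hc', hsol⟩ := exists_geodesic_equation_solution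
    (chartAt E q).open_target (contDiffOn_chartForm he)
    (fun y hy u hu ↦ chartMetric_pos he hy hu) (mem_chart_target E q)
  refine ⟨O, fun v ↦ c v 1, hO, h0, hc, hc', fun v hv ↦ ?_⟩
  obtain ⟨hv0, hvd, hvt⟩ := hsol v hv
  have hγ : IsUnitTimeGeodesic (E := E) q v _ := isUnitTimeGeodesic_chartAt_symm hv0 hvd hvt
  exact ⟨(hvt 1 (by norm_num)).1, ⟨_, hγ⟩, hγ.riemannianExp_eq⟩

variable (E) in
/-- The identification of the tangent space at `q`, with the Riemannian norm, and the model space. -/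
noncomputable def tangentSpaceEquiv (q : Q) : TangentSpace 𝓘(ℝ, E) q ≃L[ℝ] E :=
  ContinuousLinearEquiv.refl ℝ E

/-- The exponential map restricts to diffeomorphisms of arbitrarily small balls around `0`, for the
Riemannian norm on the tangent space, onto arbitrarily small neighbourhoods of `q`. -/
theorem exists_partialDiffeomorph_riemannianExp [T2Space Q] (q : Q)
    {N : Set (TangentSpace 𝓘(ℝ, E) q)} (hN : N ∈ 𝓝 0) {W : Set Q} (hW : W ∈ 𝓝 q) :
    ∃ Φ : PartialDiffeomorph 𝓘(ℝ, TangentSpace 𝓘(ℝ, E) q) 𝓘(ℝ, E)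
        (TangentSpace 𝓘(ℝ, E) q) Q ∞,
      (∃ r > 0, Φ.source = Metric.ball 0 r) ∧ Φ.source ⊆ expDomain q ∧
        EqOn (riemannianExp q) Φ Φ.source ∧ Φ.source ⊆ N ∧ Φ.target ⊆ W := by
  obtain ⟨O, f, hO, h0, hf, hf', hexp⟩ := exists_riemannianExp_eq (E := E) q
  set e := chartAt E q
  have he : e ∈ IsManifold.maximalAtlas 𝓘(ℝ, E) ∞ Q := IsManifold.chart_mem_maximalAtlas q
  let ι := tangentSpaceEquiv E q
  have : CompleteSpace (TangentSpace 𝓘(ℝ, E) q) :=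
    have : FiniteDimensional ℝ (TangentSpace 𝓘(ℝ, E) q) := inferInstanceAs (FiniteDimensional ℝ E)
    FiniteDimensional.complete ℝ _
  have hfι : ContDiffOn ℝ ∞ (fun v ↦ f (ι v)) (ι ⁻¹' O) :=
    hf.comp ι.contDiff.contDiffOn fun _ h ↦ h
  have hfι' : HasFDerivAt (fun v ↦ f (ι v))
      (ι : TangentSpace 𝓘(ℝ, E) q →L[ℝ] E) 0 :=
    HasFDerivAt.comp (0 : TangentSpace 𝓘(ℝ, E) q) (g := f) (f := ι)
      (g' := ContinuousLinearMap.id ℝ E) hf' ι.hasFDerivAt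
  have hOι : IsOpen (ι ⁻¹' O) := hO.preimage ι.continuous
  obtain ⟨ψ, hψ0, hψO, hψf, hψsymm⟩ := hfι.exists_openPartialHomeomorph hOι h0 hfι'
  have hf0 : e.symm (f 0) = q :=
    (hexp 0 h0).2.2.symm.trans (riemannianExp_zero E q)
  have hcont : ContinuousAt (fun v ↦ e.symm (ψ v)) 0 := by
    refine ContinuousAt.comp (g := e.symm) (f := ψ) ?_ (ψ.continuousAt hψ0)
    refine e.continuousAt_symm ?_
    rw [hψf]
    exact (hexp 0 h0).1
  have hWn : ∀ᶠ v in 𝓝 (0 : TangentSpace 𝓘(ℝ, E) q), e.symm (ψ v) ∈ W := by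
    refine hcont.eventually ?_
    have h : e.symm (ψ 0) = q := by rw [hψf]; exact hf0
    change W ∈ 𝓝 (e.symm (ψ 0))
    rwa [h]
  obtain ⟨r, hr, hball⟩ := Metric.mem_nhds_iff.1
    (Filter.inter_mem (Filter.inter_mem (ψ.open_source.mem_nhds hψ0) hN) hWn)
  let Θ : OpenPartialHomeomorph (TangentSpace 𝓘(ℝ, E) q) Q :=
    (ψ.restrOpen (Metric.ball 0 r) Metric.isOpen_ball).trans e.symm
  have hΘ : ∀ v, Θ v = e.symm (f (ι v)) := fun v ↦ congrArg e.symm (hψf v)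
  have hsrc : Θ.source = Metric.ball 0 r := by
    refine Subset.antisymm (fun v hv ↦ hv.1.2) fun v hv ↦ ⟨⟨(hball hv).1.1, hv⟩, ?_⟩
    change ψ v ∈ e.target
    rw [hψf]
    exact (hexp _ (hψO (hball hv).1.1)).1
  have hvO : ∀ v ∈ Θ.source, ι v ∈ O := fun v hv ↦ hψO hv.1.1
  let Φ : PartialDiffeomorph 𝓘(ℝ, TangentSpace 𝓘(ℝ, E) q) 𝓘(ℝ, E)
      (TangentSpace 𝓘(ℝ, E) q) Q ∞ :=
    { toPartialEquiv := Θ.toPartialEquiv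
      open_source := Θ.open_source
      open_target := Θ.open_target
      contMDiffOn_toFun := by
        refine ContMDiffOn.congr ?_ fun v _ ↦ hΘ v
        exact (contMDiffOn_symm_of_mem_maximalAtlas he).comp (hfι.contMDiffOn.mono hvO)
          fun v hv ↦ (hexp _ (hvO v hv)).1
      contMDiffOn_invFun :=
        hψsymm.contMDiffOn.comp ((contMDiffOn_of_mem_maximalAtlas he).mono fun x hx ↦ hx.1)
          fun x hx ↦ hx.2.1 }
  refine ⟨Φ, ⟨r, hr, hsrc⟩, fun v hv ↦ (hexp _ (hvO v hv)).2.1,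
    fun v hv ↦ (hexp _ (hvO v hv)).2.2.trans (hΘ v).symm,
    fun v hv ↦ (hball (hsrc ▸ hv : v ∈ Metric.ball 0 r)).1.2, fun x hx ↦ ?_⟩
  have hx' := Θ.map_target hx
  rw [hsrc] at hx'
  have := (hball hx').2
  rw [← Θ.right_inv hx]
  exact this

end LocalExp

/-! ### Invariant normal charts -/

section NormalCharts

variable {E : Type*} [NormedAddCommGroup E] [NormedSpace ℝ E]
  {Q : Type*} [TopologicalSpace Q] [ChartedSpace E Q]
  [RiemannianBundle (fun x : Q ↦ TangentSpace 𝓘(ℝ, E) x)]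
  {G : Type*} [Group G] [MulAction G Q] {q : Q}
  {Φ : PartialDiffeomorph 𝓘(ℝ, TangentSpace 𝓘(ℝ, E) q) 𝓘(ℝ, E)
    (TangentSpace 𝓘(ℝ, E) q) Q ∞} {v : TangentSpace 𝓘(ℝ, E) q}

namespace IsInvariantNormalChart

theorem riemannianExp_eventuallyEq (hΦ : IsInvariantNormalChart G q Φ) (hv : v ∈ Φ.source) :
    riemannianExp q =ᶠ[𝓝 v] Φ :=
  hΦ.eqOn.eventuallyEq_of_mem (Φ.open_source.mem_nhds hv)

theorem contMDiffAt_riemannianExp (hΦ : IsInvariantNormalChart G q Φ) (hv : v ∈ Φ.source) :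
    ContMDiffAt 𝓘(ℝ, TangentSpace 𝓘(ℝ, E) q) 𝓘(ℝ, E) ∞ (riemannianExp q) v :=
  (Φ.contMDiffOn.contMDiffAt (Φ.open_source.mem_nhds hv)).congr_of_eventuallyEq
    (hΦ.riemannianExp_eventuallyEq hv)

theorem isInvertible_mfderiv (hΦ : IsInvariantNormalChart G q Φ) (hv : v ∈ Φ.source) :
    (mfderiv 𝓘(ℝ, TangentSpace 𝓘(ℝ, E) q) 𝓘(ℝ, E) (riemannianExp q) v).IsInvertible := by
  have h : IsLocalDiffeomorphAt 𝓘(ℝ, TangentSpace 𝓘(ℝ, E) q) 𝓘(ℝ, E) ∞ (riemannianExp q) v :=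
    ⟨Φ, hv, hΦ.eqOn⟩
  exact ⟨h.mfderivToContinuousLinearEquiv (by simp), h.mfderivToContinuousLinearEquiv_coe (by simp)⟩

end IsInvariantNormalChart

variable [FiniteDimensional ℝ E] [T2Space Q] [IsManifold 𝓘(ℝ, E) ∞ Q]
  [IsContMDiffRiemannianBundle 𝓘(ℝ, E) ∞ E (fun x : Q ↦ TangentSpace 𝓘(ℝ, E) x)]

theorem exists_isInvariantNormalChart (hG : ActsByIsometries E Q G)
    {N : Set (TangentSpace 𝓘(ℝ, E) q)} (hN : N ∈ 𝓝 0) {W : Set Q} (hW : W ∈ 𝓝 q) :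
    ∃ Φ : PartialDiffeomorph 𝓘(ℝ, TangentSpace 𝓘(ℝ, E) q) 𝓘(ℝ, E)
        (TangentSpace 𝓘(ℝ, E) q) Q ∞,
      IsInvariantNormalChart G q Φ ∧ Φ.source ⊆ N ∧ Φ.target ⊆ W := by
  obtain ⟨Φ, ⟨r, hr, hsrc⟩, hdom, heq, hΦN, hΦW⟩ :=
    exists_partialDiffeomorph_riemannianExp q hN hW
  refine ⟨Φ, ⟨?_, hdom, heq, fun h v hv ↦ ?_⟩, hΦN, hΦW⟩
  · rw [hsrc]
    exact Metric.mem_ball_self hr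
  · rw [hsrc, mem_ball_zero_iff] at hv ⊢
    rwa [hG.norm_isotropyRep]

namespace IsInvariantNormalChart

theorem base_mem_target (hΦ : IsInvariantNormalChart G q Φ) : q ∈ Φ.target := by
  have h0 : q = Φ 0 := (riemannianExp_zero E q).symm.trans (hΦ.eqOn hΦ.zero_mem)
  exact mem_of_eq_of_mem h0 (Φ.map_source hΦ.zero_mem)

/-- The target is `Exp_q(V)`, the source `V` is invariant, and `Exp_q` intertwines the two actions.
-/
theorem smul_mem_target (hΦ : IsInvariantNormalChart G q Φ) (hG : ActsByIsometries E Q G)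
    (hs : ∀ g : G, ContMDiff 𝓘(ℝ, E) 𝓘(ℝ, E) ∞ fun x : Q ↦ g • x)
    (h : MulAction.stabilizer G q) {x : Q} (hx : x ∈ Φ.target) : (h : G) • x ∈ Φ.target := by
  have hv : Φ.invFun x ∈ Φ.source := Φ.map_target hx
  have hx' : riemannianExp q (Φ.invFun x) = x := (hΦ.eqOn hv).trans (Φ.right_inv hx)
  have hLv := hΦ.invariant h _ hv
  rw [← hx', ← hG.riemannianExp_isotropyRep hs h (hΦ.subset_domain hv), hΦ.eqOn hLv]
  exact Φ.map_source hLv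

/-- The derivative of the equivariance of the exponential map. -/
theorem mfderiv_riemannianExp_isotropyRep (hΦ : IsInvariantNormalChart G q Φ)
    (hG : ActsByIsometries E Q G)
    (hs : ∀ g : G, ContMDiff 𝓘(ℝ, E) 𝓘(ℝ, E) ∞ fun x : Q ↦ g • x)
    (h : MulAction.stabilizer G q) (hv : v ∈ Φ.source) (w : TangentSpace 𝓘(ℝ, E) q) :
    (mfderiv 𝓘(ℝ, TangentSpace 𝓘(ℝ, E) q) 𝓘(ℝ, E) (riemannianExp q) (isotropyRep E q h v)
      (isotropyRep E q h w) : E) =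
    mfderiv 𝓘(ℝ, E) 𝓘(ℝ, E) (fun x : Q ↦ (h : G) • x) (riemannianExp q v)
      (mfderiv 𝓘(ℝ, TangentSpace 𝓘(ℝ, E) q) 𝓘(ℝ, E) (riemannianExp q) v w) := by
  have hLv := hΦ.invariant h v hv
  have heq : (fun u ↦ riemannianExp q (isotropyRep E q h u)) =ᶠ[𝓝 v]
      fun u ↦ (h : G) • riemannianExp q u := by
    filter_upwards [Φ.open_source.mem_nhds hv] with u hu
    exact hG.riemannianExp_isotropyRep hs h (hΦ.subset_domain hu)
  have h1 := mfderiv_comp v (g := riemannianExp q) (f := isotropyRep E q h)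
    ((hΦ.contMDiffAt_riemannianExp hLv).mdifferentiableAt (by simp))
    (isotropyRep E q h).differentiableAt.mdifferentiableAt
  have h2 := mfderiv_comp v (g := fun x : Q ↦ (h : G) • x) (f := riemannianExp q)
    ((hs h).mdifferentiableAt (by simp))
    ((hΦ.contMDiffAt_riemannianExp hv).mdifferentiableAt (by simp))
  rw [mfderiv_eq_fderiv, ContinuousLinearMap.fderiv] at h1
  have h3 := heq.mfderiv_eq (I := 𝓘(ℝ, TangentSpace 𝓘(ℝ, E) q)) (I' := 𝓘(ℝ, E))
  exact (DFunLike.congr_fun h1 w).symm.trans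
    ((DFunLike.congr_fun h3 w).trans (DFunLike.congr_fun h2 w))

/-- The pullback of an equivariant vector field by the exponential map is equivariant. -/
theorem isotropyRep_mpullback (hΦ : IsInvariantNormalChart G q Φ)
    (hG : ActsByIsometries E Q G)
    (hs : ∀ g : G, ContMDiff 𝓘(ℝ, E) 𝓘(ℝ, E) ∞ fun x : Q ↦ g • x)
    {X : ∀ x : Q, TangentSpace 𝓘(ℝ, E) x} (hX : IsEquivariantField G X)
    (h : MulAction.stabilizer G q) (hv : v ∈ Φ.source) :
    isotropyRep E q h (VectorField.mpullback 𝓘(ℝ, TangentSpace 𝓘(ℝ, E) q) 𝓘(ℝ, E)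
        (riemannianExp q) X v) =
      VectorField.mpullback 𝓘(ℝ, TangentSpace 𝓘(ℝ, E) q) 𝓘(ℝ, E)
        (riemannianExp q) X (isotropyRep E q h v) := by
  have hLv := hΦ.invariant h v hv
  obtain ⟨D₁, hD₁⟩ := hΦ.isInvertible_mfderiv hv
  obtain ⟨D₂, hD₂⟩ := hΦ.isInvertible_mfderiv hLv
  have key : ∀ {p p' : Q}, p = p' → (X p : E) = (X p' : E) := by rintro p _ rfl; rfl
  -- The differentiated intertwining identity is applied to the pulled back vector `D₁⁻¹ (X (Exp_q
  -- v))`, so that `D₁` cancels and the equivariance of `X` applies.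
  have hder := hΦ.mfderiv_riemannianExp_isotropyRep hG hs h hv (D₁.symm (X (riemannianExp q v)))
  rw [← hD₁, ← hD₂] at hder
  rw [VectorField.mpullback_apply, VectorField.mpullback_apply, ← hD₁, ← hD₂,
    ContinuousLinearMap.inverse_equiv, ContinuousLinearMap.inverse_equiv]
  refine (ContinuousLinearEquiv.eq_symm_apply D₂).2 ?_
  have h₁ : (mfderiv 𝓘(ℝ, E) 𝓘(ℝ, E) (fun x : Q ↦ (h : G) • x) (riemannianExp q v)
      (D₁ (D₁.symm (X (riemannianExp q v)))) : E) = X ((h : G) • riemannianExp q v) :=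
    (congrArg _ (D₁.apply_symm_apply _)).trans (hX h (riemannianExp q v))
  have h₂ : (X ((h : G) • riemannianExp q v) : E) = X (riemannianExp q (isotropyRep E q h v)) :=
    key (hG.riemannianExp_isotropyRep hs h (hΦ.subset_domain hv)).symm
  exact hder.trans (h₁.trans h₂)

end IsInvariantNormalChart

end NormalCharts

/-! ### Invariant normal charts and the pullback of an equivariant vector field -/

theorem mainTheorem8
    -- a finite-dimensional smooth Riemannian manifold `Q`
    {E : Type*} [NormedAddCommGroup E] [NormedSpace ℝ E] [FiniteDimensional ℝ E]
    {Q : Type*} [TopologicalSpace Q] [T2Space Q] [ChartedSpace E Q] [IsManifold 𝓘(ℝ, E) ∞ Q]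
    [RiemannianBundle (fun x : Q ↦ TangentSpace 𝓘(ℝ, E) x)]
    [IsContMDiffRiemannianBundle 𝓘(ℝ, E) ∞ E (fun x : Q ↦ TangentSpace 𝓘(ℝ, E) x)]
    -- a Lie group `G` that acts smoothly, properly and isometrically on `Q`
    {A : Type*} [NormedAddCommGroup A] [NormedSpace ℝ A] [FiniteDimensional ℝ A]
    {G : Type*} [TopologicalSpace G] [ChartedSpace A G] [Group G] [LieGroup 𝓘(ℝ, A) ∞ G]
    [MulAction G Q] [ContMDiffSMul 𝓘(ℝ, A) 𝓘(ℝ, E) ∞ G Q] [ProperSMul G Q]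
    (hG : ActsByIsometries E Q G)
    (q : Q)
    -- a smooth `G`-equivariant vector field `X`
    (X : ∀ x : Q, TangentSpace 𝓘(ℝ, E) x)
    (hX : ContMDiff 𝓘(ℝ, E) 𝓘(ℝ, E).tangent ∞
      (fun x ↦ (⟨x, X x⟩ : TangentBundle 𝓘(ℝ, E) Q)))
    (hXG : IsEquivariantField G X) :
    -- there are arbitrarily small invariant neighbourhoods `V` and `U` as in the construction
    (∀ N ∈ 𝓝 (0 : TangentSpace 𝓘(ℝ, E) q), ∀ W ∈ 𝓝 q,
      ∃ Φ : PartialDiffeomorph 𝓘(ℝ, TangentSpace 𝓘(ℝ, E) q) 𝓘(ℝ, E)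
          (TangentSpace 𝓘(ℝ, E) q) Q ∞,
        IsInvariantNormalChart G q Φ ∧ Φ.source ⊆ N ∧ Φ.target ⊆ W) ∧
    -- and for all such neighbourhoods
    (∀ Φ : PartialDiffeomorph 𝓘(ℝ, TangentSpace 𝓘(ℝ, E) q) 𝓘(ℝ, E)
        (TangentSpace 𝓘(ℝ, E) q) Q ∞,
      IsInvariantNormalChart G q Φ →
        -- `U` is a `G_q`-invariant neighbourhood of `q`
        (q ∈ Φ.target ∧ ∀ h : MulAction.stabilizer G q, ∀ x ∈ Φ.target, (h : G) • x ∈ Φ.target) ∧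
        -- the pullback `Exp_q^* (X|_U)` is a smooth vector field on `V`
        ContMDiffOn 𝓘(ℝ, TangentSpace 𝓘(ℝ, E) q) 𝓘(ℝ, TangentSpace 𝓘(ℝ, E) q).tangent ∞
          (fun v ↦ (⟨v, VectorField.mpullback 𝓘(ℝ, TangentSpace 𝓘(ℝ, E) q) 𝓘(ℝ, E)
              (riemannianExp q) X v⟩ :
            TangentBundle 𝓘(ℝ, TangentSpace 𝓘(ℝ, E) q) (TangentSpace 𝓘(ℝ, E) q)))
          Φ.source ∧
        -- and it is `G_q`-equivariant
        ∀ h : MulAction.stabilizer G q, ∀ v ∈ Φ.source,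
          mfderiv 𝓘(ℝ, TangentSpace 𝓘(ℝ, E) q) 𝓘(ℝ, TangentSpace 𝓘(ℝ, E) q)
              (isotropyRep E q h) v
              (VectorField.mpullback 𝓘(ℝ, TangentSpace 𝓘(ℝ, E) q) 𝓘(ℝ, E)
                (riemannianExp q) X v) =
            VectorField.mpullback 𝓘(ℝ, TangentSpace 𝓘(ℝ, E) q) 𝓘(ℝ, E)
              (riemannianExp q) X (isotropyRep E q h v)) := by
  have hs : ∀ g : G, ContMDiff 𝓘(ℝ, E) 𝓘(ℝ, E) ∞ fun x : Q ↦ g • x :=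
    ContMDiffSMul.contMDiff_const_smul (I := 𝓘(ℝ, A))
  refine ⟨fun N hN W hW ↦ exists_isInvariantNormalChart hG hN hW, fun Φ hΦ ↦
    ⟨⟨hΦ.base_mem_target, fun h x hx ↦ hΦ.smul_mem_target hG hs h hx⟩, fun v hv ↦ ?_,
      fun h v hv ↦ ?_⟩⟩
  · have : CompleteSpace (TangentSpace 𝓘(ℝ, E) q) :=
      have : FiniteDimensional ℝ (TangentSpace 𝓘(ℝ, E) q) :=
        inferInstanceAs (FiniteDimensional ℝ E)
      FiniteDimensional.complete ℝ _
    exact (ContMDiffAt.mpullback_vectorField_preimage (hX _)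
      (hΦ.contMDiffAt_riemannianExp hv) (hΦ.isInvertible_mfderiv hv)
      (by simp)).contMDiffWithinAt
  -- The isotropy action is linear, hence equal to its own derivative at `v`.
  · rw [mfderiv_eq_fderiv, ContinuousLinearMap.fderiv]
    exact hΦ.isotropyRep_mpullback hG hs hXG h hv
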